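/- Let $[n]=\{1,\dots,n\}$ and $[a,b]=\{a,a+1,\dots,b\}$. A family $\mathcal F\subseteq\binom{[n]}{k}$ is $d$-wise intersecting if $F_1\cap\dots\cap F_d\neq\emptyset$ for all (not necessarily distinct) $F_1,\dots,F_d\in\mathcal F$; it is non-trivial if no element of $[n]$ lies in all members of $\mathcal F$; a $d$-wise intersecting family $\mathcal F\subseteq\binom{[n]}{k}$ is maximal if $\mathcal F\cup\{A\}$ is not $d$-wise intersecting for every $A\in\binom{[n]}{k}\setminus\mathcal F$. Write $\mathcal F\cong\mathcal F'$ if some permutation of $[n]$ maps $\mathcal F$ onto $\mathcal F'$. A maximal non-trivial $d$-wise intersecting family $\mathcal F\subseteq\binom{[n]}{k}$ is called third largest if exactly two distinct sizes greater than $|\mathcal F|$ occur among the maximal non-trivial $d$-wise intersecting families in $\binom{[n]}{k}$. For $2\le l\le k-d+2$ put $$\mathcal H(k,d,l)=\Big\{F\in\tbinom{[n]}{k}:[d-1]\subseteq F,\ F\cap[d,d+l-1]\neq\emptyset\Big\}\cup\Big\{F\in\tbinom{[n]}{k}:|[d-1]\cap F|=d-2,\ [d,d+l-1]\subseteq F\Big\},$$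 and put $$\begin{aligned}\mathcal G(k,d)=&\Big\{F\in\tbinom{[n]}{k}:[d-1]\subseteq F,\ F\cap[d,k-1]\neq\emptyset\Big\}\cup\{[2,k]\cup\{i\}:i\in[k+2,n]\}\\&\cup\Big\{F\in\tbinom{[n]}{k}:[d-1]\cup[k,k+1]\subseteq F\Big\}\cup\{[2,k-1]\cup\{k+1,i\}:i\in[k+2,n]\}\\&\cup\Big\{F\in\tbinom{[n]}{k}:|[d-1]\cap F|=d-2,\ [d,k+1]\subseteq F\Big\}.\end{aligned}$$ Let $k>d+1\ge 4$, let $n>n_1(k,d)=d+2(k-d)^2\,(k^{k-d}-1)^k\,k!$, and let $\mathcal F$ be a family of subsets of $[n]$. Then: (1) if $k\le 2d$, then $\mathcal F$ is a third largest maximal non-trivial $d$-wise intersecting family in $\binom{[n]}{k}$ if and only if $\mathcal F\cong\mathcal H(k,d,k-d+1)$; (2) if $k=2d+1$, then $\mathcal F$ is a third largest maximal non-trivial $d$-wise intersecting family in $\binom{[n]}{k}$ if and only if $\mathcal F\cong\mathcal H(2d+1,d,2)$; (3) if $k>2d+1$, then $\mathcal F$ is a third largest maximal non-trivial $d$-wise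 intersecting family in $\binom{[n]}{k}$ if and only if $\mathcal F\cong\mathcal G(k,d)$. -/

import Mathlib

namespace DWise

/-- The ground set `[n] = {1, …, n}` is modelled by `Fin n`, the element `x : Fin n` standing for
the integer `x + 1`. `seg n a b` is the integer interval `[a, b]` inside `[n]`. -/
def seg (n a b : ℕ) : Finset (Fin n) :=
  Finset.univ.filter fun x => a ≤ x.val + 1 ∧ x.val + 1 ≤ b

/-- The family of all `k`-subsets of `[n]`. -/
def kSubsets (n k : ℕ) : Finset (Finset (Fin n)) :=
  Finset.powersetCard k Finset.univ

/-- Any `d` (not necessarily distinct) members have a common element. -/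
def IsDWiseIntersecting {n : ℕ} (d : ℕ) (F : Finset (Finset (Fin n))) : Prop :=
  ∀ A : Fin d → Finset (Fin n), (∀ i, A i ∈ F) → ∃ x, ∀ i, x ∈ A i

/-- All members contain a common element. -/
def IsTrivial {n : ℕ} (F : Finset (Finset (Fin n))) : Prop :=
  ∃ x, ∀ A ∈ F, x ∈ A

/-- Maximal non-trivial `d`-wise intersecting `k`-uniform families on `[n]`. -/
structure IsMaxNontrivial {n : ℕ} (k d : ℕ) (F : Finset (Finset (Fin n))) : Prop where
  uniform : F ⊆ kSubsets n k
  intersecting : IsDWiseIntersecting d F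
  nontrivial : ¬ IsTrivial F
  maximal : ∀ A ∈ kSubsets n k \ F, ¬ IsDWiseIntersecting d (insert A F)

/-- `F` is an `r`-th largest maximal non-trivial `d`-wise intersecting `k`-uniform family on `[n]`:
exactly `r - 1` different sizes larger than `|F|` occur among all these families. -/
def IsNthLargest {n : ℕ} (r k d : ℕ) (F : Finset (Finset (Fin n))) : Prop :=
  IsMaxNontrivial k d F ∧
    {m : ℕ | F.card < m ∧
      ∃ F' : Finset (Finset (Fin n)), IsMaxNontrivial k d F' ∧ F'.card = m}.ncard + 1 = r

/-- Isomorphism of families: some permutation of `[n]` carries `F` onto `F'`. -/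
def Iso {n : ℕ} (F F' : Finset (Finset (Fin n))) : Prop :=
  ∃ π : Equiv.Perm (Fin n), F.image (fun A => A.image π) = F'

/-- The family `H(k, d, l)` on `[n]`. -/
def familyH (n k d l : ℕ) : Finset (Finset (Fin n)) :=
  ((kSubsets n k).filter fun F =>
      seg n 1 (d - 1) ⊆ F ∧ (F ∩ seg n d (d + l - 1)).Nonempty) ∪
    ((kSubsets n k).filter fun F =>
      (seg n 1 (d - 1) ∩ F).card = d - 2 ∧ seg n d (d + l - 1) ⊆ F)

/-- The family `G(k, d)` on `[n]`. -/
def familyG (n k d : ℕ) : Finset (Finset (Fin n)) :=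
  ((kSubsets n k).filter fun F =>
      seg n 1 (d - 1) ⊆ F ∧ (F ∩ seg n d (k - 1)).Nonempty) ∪
    (seg n (k + 2) n).image (fun i => seg n 2 k ∪ {i}) ∪
    ((kSubsets n k).filter fun F => seg n 1 (d - 1) ∪ seg n k (k + 1) ⊆ F) ∪
    (seg n (k + 2) n).image (fun i => seg n 2 (k - 1) ∪ (seg n (k + 1) (k + 1) ∪ {i})) ∪
    ((kSubsets n k).filter fun F =>
      (seg n 1 (d - 1) ∩ F).card = d - 2 ∧ seg n d (k + 1) ⊆ F)

/-- The threshold `n₁(k, d) = d + 2 (k - d)² (k ^ (k - d) - 1) ^ k k!`. -/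
def n₁ (k d : ℕ) : ℕ :=
  d + 2 * (k - d) ^ 2 * (k ^ (k - d) - 1) ^ k * k.factorial

end DWise

namespace DWise

open Finset

/-! ### Hitting sets and the consequences of maximality -/

section

/-! Call a set hitting if it meets the common part of any at most d - 1 members (`Hits`). In a
maximal non-trivial family F every member is hitting and every k-superset of a hitting set is a
member. By non-triviality a hitting set shares at least d - 1 points with each member, and it has at
least d points itself. Put r = k - d and N = n - d, and let `gens` be the hitting sets of size
exactly d. Members containing no generator are found by branching from non-hitting sets, so there
are only O(C(N-1, r-1)) of them; hence |F| is at most |gens| · C(N, r) up to lower order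
(`IsMaxNontrivial.card_le`).

Two generators always share d - 1 points. Hence three or more of them either lie in one (d+1)-set,
which forces H(k,d,2) (`eq_starH_of_gens_subset`), or are the sets D ∪ {x}, x ∈ X, for a core D of
size d - 1 (`IsCore`). In the core case a member not containing D misses exactly one point of D,
contains X, and has r + 2 - |X| further points. So |X| ≤ r + 2. If |X| is r + 1 or r + 2, then F is
H(k,d,|X|) (`IsCore.eq_starH`). If |X| = r, then F is a copy of G, or the members that contain D and
avoid X are of lower order than in G (`IsCore.eq_starG_or_card_le`).

The coefficients of C(N, r) are thus d + 1 for H(k,d,2), r + 2 and r + 1 for the two large H, r for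
G, and at most r for everything else. Comparing r with d gives the three cases of the theorem.
H(k,d,2) ties with one of the others when r is d - 1, d or d + 1; the terms of order C(N-1, r-1)
decide these ties (`meetCount_second_order`), and the threshold on n makes all remaining errors
negligible. -/

/-- Every intersection of at most `d - 1` members of `F` meets `T`. -/
def Hits {n : ℕ} (d : ℕ) (F : Finset (Finset (Fin n))) (T : Finset (Fin n)) : Prop :=
  ∀ S ⊆ F, S.card + 1 ≤ d → ∃ x ∈ T, ∀ A ∈ S, x ∈ A

variable {n k d : ℕ} {F : Finset (Finset (Fin n))} {D X T A : Finset (Fin n)}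

theorem mem_kSubsets : A ∈ kSubsets n k ↔ A.card = k := by
  simp [kSubsets]

theorem isDWiseIntersecting_iff (hn : 0 < n) :
    IsDWiseIntersecting d F ↔ ∀ S ⊆ F, S.card ≤ d → ∃ x, ∀ A ∈ S, x ∈ A := by
  constructor
  · intro h S hS hc
    rcases S.eq_empty_or_nonempty with rfl | ⟨A0, hA0⟩
    · exact ⟨⟨0, hn⟩, by simp⟩
    · let f : Fin d → Finset (Fin n) := fun i =>
        if hi : i.val < S.card then (S.equivFin.symm ⟨i.val, hi⟩ : S).1 else A0
      have hf : ∀ i, f i ∈ S := by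
        intro i
        dsimp only [f]
        split_ifs
        · exact Subtype.property _
        · exact hA0
      obtain ⟨x, hx⟩ := h f fun i => hS (hf i)
      refine ⟨x, fun A hA => ?_⟩
      have hlt := (S.equivFin ⟨A, hA⟩).2
      have := hx ⟨(S.equivFin ⟨A, hA⟩).1, hlt.trans_le hc⟩
      simpa [f] using this
  · intro h A hA
    obtain ⟨x, hx⟩ := h (univ.image A) (by simpa [image_subset_iff] using hA)
      (card_image_le.trans (by simp))
    exact ⟨x, fun i => hx _ (mem_image_of_mem _ (mem_univ i))⟩

theorem exists_notMem_of_not_isTrivial (h : ¬ IsTrivial F) (x : Fin n) : ∃ A ∈ F, x ∉ A := by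
  simp only [IsTrivial, not_exists, not_forall] at h
  obtain ⟨A, hA, hx⟩ := h x
  exact ⟨A, hA, hx⟩

/-- In a non-trivial `d`-wise intersecting family, `j` members have at least `d + 1 - j` common
elements. -/
theorem le_card_add_card_common (hF : ∀ S ⊆ F, S.card ≤ d → ∃ x, ∀ A ∈ S, x ∈ A)
    (hnt : ¬ IsTrivial F) {S : Finset (Finset (Fin n))} (hS : S ⊆ F) :
    d + 1 ≤ S.card + (univ.filter fun x => ∀ A ∈ S, x ∈ A).card := by
  by_contra! hlt
  -- Adding to S, for each common point x, a member avoiding x gives at most d members with no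
  -- common point.
  choose B hB hxB using exists_notMem_of_not_isTrivial hnt
  set I := univ.filter fun x => ∀ A ∈ S, x ∈ A with hI
  obtain ⟨x, hx⟩ := hF (S ∪ I.image B)
    (union_subset hS (image_subset_iff.2 fun x _ => hB x))
    ((card_union_le _ _).trans (by have := card_image_le (s := I) (f := B); omega))
  have hxI : x ∈ I := by
    simp only [hI, mem_filter, mem_univ, true_and]
    exact fun A hA => hx A (mem_union_left _ hA)
  exact hxB x (hx _ (mem_union_right _ (mem_image_of_mem _ hxI)))

theorem Hits.insert (hF : ∀ S ⊆ F, S.card ≤ d → ∃ x, ∀ A ∈ S, x ∈ A) (hT : Hits d F T) :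
    ∀ S ⊆ insert T F, S.card ≤ d → ∃ x, ∀ A ∈ S, x ∈ A := by
  intro S hS hc
  by_cases hTS : T ∈ S
  · obtain ⟨x, hxT, hx⟩ := hT (S.erase T) (by rwa [← subset_insert_iff])
      (by rw [card_erase_add_one hTS]; exact hc)
    refine ⟨x, fun A hA => ?_⟩
    by_cases hAT : A = T
    · rwa [hAT]
    · exact hx A (mem_erase.2 ⟨hAT, hA⟩)
  · exact hF S ((subset_insert_iff_of_notMem hTS).1 hS) hc

theorem not_isTrivial_mono {F' : Finset (Finset (Fin n))} (h : F ⊆ F') (hnt : ¬ IsTrivial F) :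
    ¬ IsTrivial F' :=
  fun ⟨x, hx⟩ => hnt ⟨x, fun A hA => hx A (h hA)⟩

/-- Adjoining T keeps the family d-wise intersecting and non-trivial, so the bound on common parts
applies to the pair {T, A}. This is the main tool against unwanted members. -/
theorem Hits.le_card_inter (hF : ∀ S ⊆ F, S.card ≤ d → ∃ x, ∀ A ∈ S, x ∈ A)
    (hnt : ¬ IsTrivial F) (hT : Hits d F T) (hA : A ∈ F) : d ≤ (T ∩ A).card + 1 := by
  have h := le_card_add_card_common (hT.insert hF) (not_isTrivial_mono (subset_insert _ _) hnt)
    (S := {T, A}) (by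
      intro B hB
      simp only [mem_insert, mem_singleton] at hB ⊢
      rcases hB with rfl | rfl
      · exact Or.inl rfl
      · exact Or.inr hA)
  have h2 : (univ.filter fun x => ∀ B ∈ ({T, A} : Finset (Finset (Fin n))), x ∈ B) = T ∩ A := by
    ext x; simp
  rw [h2] at h
  have := card_le_two (a := T) (b := A)
  omega

theorem hits_of_mem (hF : ∀ S ⊆ F, S.card ≤ d → ∃ x, ∀ A ∈ S, x ∈ A) (hA : A ∈ F) :
    Hits d F A := by
  intro S hS hc
  obtain ⟨x, hx⟩ := hF (Insert.insert A S) (insert_subset hA hS) ((card_insert_le _ _).trans hc)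
  exact ⟨x, hx A (mem_insert_self _ _), fun B hB => hx B (mem_insert_of_mem hB)⟩

theorem Hits.mono {T' : Finset (Fin n)} (h : T ⊆ T') (hT : Hits d F T) : Hits d F T' := by
  intro S hS hc
  obtain ⟨x, hx, h'⟩ := hT S hS hc
  exact ⟨x, h hx, h'⟩

theorem Hits.le_card (hd : 2 ≤ d) (hF : ∀ S ⊆ F, S.card ≤ d → ∃ x, ∀ A ∈ S, x ∈ A)
    (hnt : ¬ IsTrivial F) (hT : Hits d F T) : d ≤ T.card := by
  by_contra! hlt
  obtain ⟨x, hx, -⟩ := hT ∅ (empty_subset _) (by simp; omega)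
  refine hnt ⟨x, fun A hA => ?_⟩
  have h1 := hT.le_card_inter hF hnt hA
  have h2 : T ∩ A = T := eq_of_subset_of_card_le inter_subset_left (by omega)
  rw [← h2] at hx
  exact mem_of_mem_inter_right hx

theorem IsMaxNontrivial.dwise (hF : IsMaxNontrivial k d F) (hn : 0 < n) :
    ∀ S ⊆ F, S.card ≤ d → ∃ x, ∀ A ∈ S, x ∈ A :=
  (isDWiseIntersecting_iff hn).1 hF.intersecting

theorem IsMaxNontrivial.card_eq (hF : IsMaxNontrivial k d F) (hA : A ∈ F) : A.card = k :=
  mem_kSubsets.1 (hF.uniform hA)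

theorem Hits.mem_of_superset (hn : 0 < n) (hF : IsMaxNontrivial k d F)
    (hT : Hits d F T) (hTA : T ⊆ A) (hA : A.card = k) : A ∈ F := by
  by_contra hAF
  refine hF.maximal A (mem_sdiff.2 ⟨mem_kSubsets.2 hA, hAF⟩) ?_
  exact (isDWiseIntersecting_iff hn).2 ((hT.mono hTA).insert (hF.dwise hn))

theorem IsMaxNontrivial.eq_of_subset (hF : IsMaxNontrivial k d F)
    {F' : Finset (Finset (Fin n))} (h : F ⊆ F') (hu : F' ⊆ kSubsets n k)
    (hF' : IsDWiseIntersecting d F') : F = F' := by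
  refine h.antisymm fun A hA => ?_
  by_contra hAF
  exact hF.maximal A (mem_sdiff.2 ⟨hu hA, hAF⟩)
    fun B hB => hF' B fun i => (insert_subset hA h) (hB i)

theorem exists_superset_disjoint {Z : Finset (Fin n)} (hTZ : Disjoint T Z) (hT : T.card ≤ k)
    (hZ : Z.card + k ≤ n) : ∃ A : Finset (Fin n), A.card = k ∧ T ⊆ A ∧ Disjoint A Z := by
  obtain ⟨A, h1, h2, h3⟩ := exists_subsuperset_card_eq (s := T) (t := Zᶜ) (n := k)
    (subset_compl_iff_disjoint_right.2 hTZ) hT (by rw [card_compl, Fintype.card_fin]; omega)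
  exact ⟨A, h3, h1, subset_compl_iff_disjoint_right.1 h2⟩

/-- If all `k`-supersets of `T` belong to `F` then `T` hits all `(d - 1)`-fold intersections. -/
theorem hits_of_forall_superset (hkn : 2 * k ≤ n)
    (hF : ∀ S ⊆ F, S.card ≤ d → ∃ x, ∀ A ∈ S, x ∈ A) (hu : F ⊆ kSubsets n k)
    (hT0 : T.Nonempty) (hTk : T.card ≤ k) (h : ∀ A : Finset (Fin n), A.card = k → T ⊆ A → A ∈ F) :
    Hits d F T := by
  intro S hS hc
  rcases S.eq_empty_or_nonempty with rfl | ⟨A0, hA0⟩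
  · obtain ⟨x, hx⟩ := hT0
    exact ⟨x, hx, by simp⟩
  by_contra! hcon
  -- The common part of S has at most k points and misses T, so some k-superset of T avoids it; that
  -- superset is a member, hence hitting.
  obtain ⟨A, hA, hTA, hdis⟩ := exists_superset_disjoint
    (T := T) (Z := univ.filter fun x => ∀ A ∈ S, x ∈ A) (k := k)
    (disjoint_left.2 fun x hxT hx => by
      obtain ⟨B, hB, hxB⟩ := hcon x hxT
      exact hxB ((mem_filter.1 hx).2 B hB)) hTk (by
    have : (univ.filter fun x => ∀ A ∈ S, x ∈ A).card ≤ A0.card :=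
      card_le_card fun x hx => (mem_filter.1 hx).2 A0 hA0
    rw [mem_kSubsets.1 (hu (hS hA0))] at this
    omega)
  obtain ⟨x, hxA, hx⟩ := hits_of_mem hF (h A hA hTA) S hS hc
  exact disjoint_left.1 hdis hxA (by simpa using hx)

/-- Members of `F` avoiding the elements of `D` can be chosen freely for two elements of `D`. -/
theorem Hits.exists_mem_two (hnt : ¬ IsTrivial F) (hD : D.card + 1 = d) (hT : Hits d F T)
    {A₁ A₂ : Finset (Fin n)} (h1 : A₁ ∈ F) (h2 : A₂ ∈ F) {x₁ x₂ : Fin n} (hx1 : x₁ ∈ D)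
    (hx2 : x₂ ∈ D) (hxA1 : x₁ ∉ A₁) (hxA2 : x₂ ∉ A₂) (hne : x₁ ≠ x₂) :
    ∃ z ∈ T, z ∉ D ∧ z ∈ A₁ ∧ z ∈ A₂ := by
  choose B hB hxB using exists_notMem_of_not_isTrivial hnt
  -- One member avoiding each point of D, with A₁ and A₂ prescribed at x₁ and x₂. These are at most
  -- d - 1 members whose common part avoids D, so T meets that common part outside D.
  set B' := Function.update (Function.update B x₁ A₁) x₂ A₂ with hB'
  have e1 : B' x₁ = A₁ := by simp [hB', hne]
  have e2 : B' x₂ = A₂ := by simp [hB']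
  have hF' : ∀ x, B' x ∈ F ∧ x ∉ B' x := by
    intro x
    by_cases hx : x = x₂
    · subst hx; rw [e2]; exact ⟨h2, hxA2⟩
    by_cases hx' : x = x₁
    · subst hx'; rw [e1]; exact ⟨h1, hxA1⟩
    · simp [hB', hx, hx', hB, hxB]
  obtain ⟨z, hz, h⟩ := hT (D.image B') (image_subset_iff.2 fun x _ => (hF' x).1)
    (by have := card_image_le (s := D) (f := B'); omega)
  refine ⟨z, hz, fun hzD => (hF' z).2 (h _ (mem_image_of_mem _ hzD)), ?_, ?_⟩
  · rw [← e1]; exact h _ (mem_image_of_mem _ hx1)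
  · rw [← e2]; exact h _ (mem_image_of_mem _ hx2)

/-- If `D ∪ {x}` hits for all `x ∈ X`, a member not containing `D` contains all of `X` and all but
one element of `D`. -/
theorem card_sdiff_eq_one_of_hits (hF : ∀ S ⊆ F, S.card ≤ d → ∃ x, ∀ A ∈ S, x ∈ A)
    (hnt : ¬ IsTrivial F) (hD : D.card + 1 = d) (hX : X.Nonempty)
    (hDX : ∀ x ∈ X, Hits d F (Insert.insert x D)) (hA : A ∈ F) (hDA : ¬ D ⊆ A) :
    (D \ A).card = 1 ∧ X ⊆ A := by
  have h0 : 1 ≤ (D \ A).card := by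
    rw [Nat.one_le_iff_ne_zero, Ne, card_eq_zero, sdiff_eq_empty_iff_subset]; exact hDA
  have h1 := card_sdiff_add_card_inter D A
  have key : ∀ x ∈ X, x ∈ A ∧ (D \ A).card = 1 := by
    intro x hx
    have h2 := (hDX x hx).le_card_inter hF hnt hA
    by_cases hxA : x ∈ A
    · rw [insert_inter_of_mem hxA] at h2
      have := card_insert_le x (D ∩ A)
      exact ⟨hxA, by omega⟩
    · rw [insert_inter_of_notMem hxA] at h2
      omega
  obtain ⟨x, hx⟩ := hX
  exact ⟨(key x hx).2, fun x hx => (key x hx).1⟩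

/-! ### The standard families -/

/-- The family `H` with respect to arbitrary disjoint sets `D` and `X`. -/
def starH (k : ℕ) (D X : Finset (Fin n)) : Finset (Finset (Fin n)) :=
  (kSubsets n k).filter fun A => (D ⊆ A ∧ (A ∩ X).Nonempty) ∨ ((D \ A).card = 1 ∧ X ⊆ A)

/-- The family `G` with respect to arbitrary disjoint sets `D`, `X`, `B` and `u ∈ D`. -/
def starG (k : ℕ) (D X B : Finset (Fin n)) (u : Fin n) : Finset (Finset (Fin n)) :=
  (kSubsets n k).filter fun A => (D ⊆ A ∧ ((A ∩ X).Nonempty ∨ B ⊆ A)) ∨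
    ((D \ A).card = 1 ∧ X ⊆ A ∧ (B ⊆ A ∨ (u ∉ A ∧ (A ∩ B).Nonempty)))

theorem mem_starH : A ∈ starH k D X ↔
    A.card = k ∧ ((D ⊆ A ∧ (A ∩ X).Nonempty) ∨ ((D \ A).card = 1 ∧ X ⊆ A)) := by
  simp [starH, mem_kSubsets]

theorem mem_starG {B : Finset (Fin n)} {u : Fin n} : A ∈ starG k D X B u ↔
    A.card = k ∧ ((D ⊆ A ∧ ((A ∩ X).Nonempty ∨ B ⊆ A)) ∨
      ((D \ A).card = 1 ∧ X ⊆ A ∧ (B ⊆ A ∨ (u ∉ A ∧ (A ∩ B).Nonempty)))) := by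
  simp [starG, mem_kSubsets]

theorem eq_of_card_sdiff_eq_one (h : (D \ A).card = 1) {x y : Fin n} (hx : x ∈ D) (hxA : x ∉ A)
    (hy : y ∈ D) (hyA : y ∉ A) : x = y :=
  card_le_one.1 h.le x (mem_sdiff.2 ⟨hx, hxA⟩) y (mem_sdiff.2 ⟨hy, hyA⟩)

/-- Reduces d-wise intersection to one configuration. If some member of S contains D and no point of
D is common to S, then distinct points of D are missed by distinct members. These d - 1 members and
the one containing D exhaust S. -/
theorem dwise_of_star (hD : D.card + 1 = d) (hF : ∀ A ∈ F, ¬ D ⊆ A → (D \ A).card = 1)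
    (x₀ : Fin n) (hx₀ : ∀ A ∈ F, ¬ D ⊆ A → x₀ ∈ A)
    (h : ∀ A ∈ F, D ⊆ A → ∀ B : Fin n → Finset (Fin n), (∀ x ∈ D, B x ∈ F ∧ x ∉ B x) →
      ∃ z ∈ A, ∀ x ∈ D, z ∈ B x) :
    ∀ S ⊆ F, S.card ≤ d → ∃ x, ∀ A ∈ S, x ∈ A := by
  intro S hS hc
  by_cases hA : ∃ A ∈ S, D ⊆ A
  swap
  · push Not at hA
    exact ⟨x₀, fun A hAS => hx₀ A (hS hAS) (hA A hAS)⟩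
  obtain ⟨A, hAS, hDA⟩ := hA
  by_cases hx : ∃ x ∈ D, ∀ A ∈ S, x ∈ A
  · obtain ⟨x, -, hx⟩ := hx
    exact ⟨x, hx⟩
  push Not at hx
  have hx' : ∀ x, ∃ B : Finset (Fin n), x ∈ D → B ∈ S ∧ x ∉ B := by
    intro x
    by_cases hxD : x ∈ D
    · obtain ⟨B, hB, hxB⟩ := hx x hxD
      exact ⟨B, fun _ => ⟨hB, hxB⟩⟩
    · exact ⟨∅, fun h => absurd h hxD⟩
  choose B hB using hx'
  have hinj : Set.InjOn B D := by
    intro x hx y hy hxy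
    have hy' := (hB y hy).2
    rw [← hxy] at hy'
    exact eq_of_card_sdiff_eq_one
      (hF _ (hS (hB x hx).1) fun hsub => (hB x hx).2 (hsub hx)) hx (hB x hx).2 hy hy'
  have hAi : A ∉ D.image B := by
    intro hmem
    obtain ⟨x, hx, rfl⟩ := mem_image.1 hmem
    exact (hB x hx).2 (hDA hx)
  have hSeq : Insert.insert A (D.image B) = S := by
    refine eq_of_subset_of_card_le
      (insert_subset hAS (image_subset_iff.2 fun x hx => (hB x hx).1)) ?_
    rw [card_insert_of_notMem hAi, card_image_of_injOn hinj]
    omega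
  obtain ⟨z, hzA, hz⟩ := h A (hS hAS) hDA B fun x hx => ⟨hS (hB x hx).1, (hB x hx).2⟩
  refine ⟨z, fun C hC => ?_⟩
  rw [← hSeq, mem_insert, mem_image] at hC
  rcases hC with rfl | ⟨x, hx, rfl⟩
  · exact hzA
  · exact hz x hx

theorem starH_dwise (hD : D.card + 1 = d) (hX : X.Nonempty) :
    ∀ S ⊆ starH k D X, S.card ≤ d → ∃ x, ∀ A ∈ S, x ∈ A := by
  have hmiss : ∀ A ∈ starH k D X, ¬ D ⊆ A → (D \ A).card = 1 ∧ X ⊆ A := by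
    intro A hA hDA
    rcases (mem_starH.1 hA).2 with h | h
    · exact absurd h.1 hDA
    · exact h
  obtain ⟨x₀, hx₀⟩ := hX
  refine dwise_of_star hD (fun A hA hDA => (hmiss A hA hDA).1) x₀
    (fun A hA hDA => (hmiss A hA hDA).2 hx₀) ?_
  intro A hA hDA B hB
  have hAX : (A ∩ X).Nonempty := by
    rcases (mem_starH.1 hA).2 with h | h
    · exact h.2
    · rw [sdiff_eq_empty_iff_subset.2 hDA] at h
      simp at h
  obtain ⟨z, hz⟩ := hAX
  rw [mem_inter] at hz
  exact ⟨z, hz.1, fun x hx => (hmiss _ (hB x hx).1 fun h => (hB x hx).2 (h hx)).2 hz.2⟩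

/-- In the critical configuration only the member missing u may fail to contain B. It still meets B,
so a set containing D ∪ B shares a point of B with all the others. -/
theorem starG_dwise {B : Finset (Fin n)} {u : Fin n} (hD : D.card + 1 = d) (hu : u ∈ D)
    (hX : X.Nonempty) (hB0 : B.Nonempty) :
    ∀ S ⊆ starG k D X B u, S.card ≤ d → ∃ x, ∀ A ∈ S, x ∈ A := by
  have hmiss : ∀ A ∈ starG k D X B u, ¬ D ⊆ A → (D \ A).card = 1 ∧ X ⊆ A ∧
      (B ⊆ A ∨ (u ∉ A ∧ (A ∩ B).Nonempty)) := by
    intro A hA hDA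
    rcases (mem_starG.1 hA).2 with h | h
    · exact absurd h.1 hDA
    · exact h
  obtain ⟨x₀, hx₀⟩ := hX
  refine dwise_of_star hD (fun A hA hDA => (hmiss A hA hDA).1) x₀
    (fun A hA hDA => (hmiss A hA hDA).2.1 hx₀) ?_
  intro A hA hDA C hC
  have hC' : ∀ x ∈ D, (D \ C x).card = 1 ∧ X ⊆ C x ∧
      (B ⊆ C x ∨ (u ∉ C x ∧ (C x ∩ B).Nonempty)) :=
    fun x hx => hmiss _ (hC x hx).1 fun h => (hC x hx).2 (h hx)
  have hA' : (A ∩ X).Nonempty ∨ B ⊆ A := by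
    rcases (mem_starG.1 hA).2 with h | h
    · exact h.2
    · rw [sdiff_eq_empty_iff_subset.2 hDA] at h
      simp at h
  rcases hA' with ⟨z, hz⟩ | hBA
  · rw [mem_inter] at hz
    exact ⟨z, hz.1, fun x hx => (hC' x hx).2.1 hz.2⟩
  · have hrest : ∀ x ∈ D, x ≠ u → B ⊆ C x := by
      intro x hx hxu
      rcases (hC' x hx).2.2 with h | h
      · exact h
      · exact absurd (eq_of_card_sdiff_eq_one (hC' x hx).1 hx (hC x hx).2 hu h.1) hxu
    by_cases hBu : (C u ∩ B).Nonempty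
    · obtain ⟨z, hz⟩ := hBu
      rw [mem_inter] at hz
      refine ⟨z, hBA hz.2, fun x hx => ?_⟩
      by_cases hxu : x = u
      · rw [hxu]; exact hz.1
      · exact hrest x hx hxu hz.2
    · have hBe : B ⊆ C u := by
        rcases (hC' u hu).2.2 with h | h
        · exact h
        · exact absurd h.2 hBu
      rw [inter_eq_right.2 hBe] at hBu
      exact absurd hB0 hBu

end

/-! ### Maximality and non-triviality of H and G -/

section

variable {n k d : ℕ} {F : Finset (Finset (Fin n))} {D X T A B : Finset (Fin n)} {u : Fin n}

theorem card_erase_union (hDX : Disjoint D X) {x : Fin n} (hx : x ∈ D) :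
    (D.erase x ∪ X).card + 1 = D.card + X.card := by
  rw [card_union_of_disjoint (hDX.mono_left (erase_subset _ _)), ← card_erase_add_one hx]
  omega

theorem sdiff_eq_singleton_of_erase_subset {x : Fin n} (hx : x ∈ D) (h : D.erase x ⊆ A)
    (hxA : x ∉ A) : D \ A = {x} := by
  ext y
  simp only [mem_sdiff, mem_singleton]
  constructor
  · rintro ⟨h1, h2⟩
    by_contra hne
    exact h2 (h (mem_erase.2 ⟨hne, h1⟩))
  · rintro rfl
    exact ⟨hx, hxA⟩

/-- A `k`-set containing `X` and missing exactly the element `x` of `D`, and otherwise avoiding a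
prescribed set. -/
theorem exists_missing (hDX : Disjoint D X) {x : Fin n} (hx : x ∈ D)
    (hc : D.card + X.card ≤ k + 1) {Z : Finset (Fin n)} (hZ : Z.card + (k + 1) ≤ n) :
    ∃ A : Finset (Fin n), A.card = k ∧ D \ A = {x} ∧ X ⊆ A ∧ x ∉ A ∧ D.erase x ⊆ A ∧
      A ∩ Z ⊆ D.erase x ∪ X := by
  have h1 := card_erase_union hDX hx
  obtain ⟨A, hA, hs, hd⟩ := exists_superset_disjoint (T := D.erase x ∪ X)
    (Z := Insert.insert x (Z \ (D.erase x ∪ X))) (k := k) (by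
      rw [disjoint_insert_right]
      refine ⟨?_, disjoint_sdiff⟩
      simp only [mem_union, mem_erase, ne_eq, not_true_eq_false, false_and, false_or]
      exact disjoint_left.1 hDX hx) (by omega) (by
      have h2 := card_insert_le x (Z \ (D.erase x ∪ X))
      have h3 := card_le_card (sdiff_subset (s := Z) (t := D.erase x ∪ X))
      omega)
  rw [disjoint_insert_right] at hd
  refine ⟨A, hA, sdiff_eq_singleton_of_erase_subset hx (subset_union_left.trans hs) hd.1,
    subset_union_right.trans hs, hd.1, subset_union_left.trans hs, ?_⟩
  intro y hy
  rw [mem_inter] at hy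
  by_contra hcon
  exact disjoint_left.1 hd.2 hy.1 (mem_sdiff.2 ⟨hy.2, hcon⟩)

theorem hits_insert_of_meet (hkn : 2 * k ≤ n) (hF : ∀ S ⊆ F, S.card ≤ d → ∃ x, ∀ A ∈ S, x ∈ A)
    (hu : F ⊆ kSubsets n k) (hD : D.card + 1 = d) (hdk : d ≤ k)
    (h : ∀ A : Finset (Fin n), A.card = k → D ⊆ A → (A ∩ X).Nonempty → A ∈ F) :
    ∀ x ∈ X, Hits d F (Insert.insert x D) := by
  intro x hx
  refine hits_of_forall_superset hkn hF hu (insert_nonempty _ _)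
    ((card_insert_le _ _).trans (by omega)) fun A hA hs => ?_
  rw [insert_subset_iff] at hs
  exact h A hA hs.2 ⟨x, mem_inter.2 ⟨hs.1, hx⟩⟩

theorem inter_subset_erase_of_disjoint {x : Fin n} {C : Finset (Fin n)}
    (hC : C ∩ A ⊆ D.erase x ∪ X) (hAX : ¬ (A ∩ X).Nonempty) : A ∩ C ⊆ D.erase x := by
  intro y hy
  rw [mem_inter] at hy
  rcases mem_union.1 (hC (mem_inter.2 ⟨hy.2, hy.1⟩)) with h | h
  · exact h
  · exact absurd ⟨y, mem_inter.2 ⟨hy.1, h⟩⟩ hAX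

theorem starH_not_isTrivial (hD : 2 ≤ D.card) (hDX : Disjoint D X) (hX : 2 ≤ X.card)
    (hc : D.card + X.card ≤ k + 1) (hkn : 2 * k ≤ n) : ¬ IsTrivial (starH k D X) := by
  rintro ⟨x, hx⟩
  by_cases hxD : x ∈ D
  · obtain ⟨A, hA, h1, h2, h3, -⟩ := exists_missing hDX hxD hc (Z := ∅) (by simp; omega)
    exact h3 (hx A (mem_starH.2 ⟨hA, Or.inr ⟨by rw [h1, card_singleton], h2⟩⟩))
  · obtain ⟨y, hy, hyx⟩ := exists_mem_ne hX x
    obtain ⟨A, hA, h1, h2⟩ := exists_superset_disjoint (T := Insert.insert y D) (Z := {x})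
      (k := k) (by simp [hxD, hyx.symm]) ((card_insert_le _ _).trans (by omega))
      (by simp; omega)
    rw [insert_subset_iff] at h1
    exact (disjoint_singleton_right.1 h2) (hx A (mem_starH.2
      ⟨hA, Or.inl ⟨h1.2, ⟨y, mem_inter.2 ⟨h1.1, hy⟩⟩⟩⟩))

/-- In an intersecting enlargement the sets D ∪ {x}, x ∈ X, are still hitting, so a new set not
containing D already has the required form. A new set containing D and avoiding X would meet a
suitable member missing one point of D in only d - 2 points. -/
theorem starH_isMaxNontrivial (hd : 3 ≤ d) (hD : D.card + 1 = d) (hDX : Disjoint D X)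
    (hX : 2 ≤ X.card) (hc : d + X.card ≤ k + 2) (hkn : 2 * k < n) :
    IsMaxNontrivial k d (starH k D X) := by
  have hX0 : X.Nonempty := card_pos.1 (by omega)
  have hnt := starH_not_isTrivial (k := k) (by omega) hDX hX (by omega) hkn.le
  refine ⟨filter_subset _ _, (isDWiseIntersecting_iff (by omega)).2 (starH_dwise hD hX0), hnt, ?_⟩
  intro A hA hcon
  rw [mem_sdiff, mem_kSubsets] at hA
  obtain ⟨hAk, hAn⟩ := hA
  rw [isDWiseIntersecting_iff (by omega)] at hcon
  set F := Insert.insert A (starH k D X) with hF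
  have hsub : starH k D X ⊆ F := subset_insert _ _
  have hnt' := not_isTrivial_mono hsub hnt
  have hu : F ⊆ kSubsets n k := insert_subset (mem_kSubsets.2 hAk) (filter_subset _ _)
  have hhit := hits_insert_of_meet (X := X) hkn.le hcon hu hD (by omega)
    fun B hB h1 h2 => hsub (mem_starH.2 ⟨hB, Or.inl ⟨h1, h2⟩⟩)
  have hAF : A ∈ F := mem_insert_self _ _
  by_cases hDA : D ⊆ A
  · by_cases hAX : (A ∩ X).Nonempty
    · exact hAn (mem_starH.2 ⟨hAk, Or.inl ⟨hDA, hAX⟩⟩)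
    obtain ⟨x, hx⟩ : D.Nonempty := card_pos.1 (by omega)
    obtain ⟨C, hC, h1, h2, h3, -, h4⟩ := exists_missing hDX hx (k := k) (by omega) (Z := A)
      (by omega)
    have hCF : C ∈ F := hsub (mem_starH.2 ⟨hC, Or.inr ⟨by rw [h1, card_singleton], h2⟩⟩)
    have := (hits_of_mem hcon hAF).le_card_inter hcon hnt' hCF
    have := card_le_card (inter_subset_erase_of_disjoint h4 hAX)
    have := card_erase_add_one hx
    omega
  · exact hAn (mem_starH.2 ⟨hAk, Or.inr (card_sdiff_eq_one_of_hits hcon hnt' hD hX0 hhit hAF hDA)⟩)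

theorem starG_not_isTrivial (hD : 2 ≤ D.card) (hDX : Disjoint D X) (hDB : Disjoint D B)
    (hXB : Disjoint X B) (hX : 2 ≤ X.card) (hB : B.card = 2)
    (hc : D.card + X.card + 1 = k) (hkn : 2 * k ≤ n) : ¬ IsTrivial (starG k D X B u) := by
  rintro ⟨x, hx⟩
  by_cases hxD : x ∈ D
  · have hDXB : Disjoint D (X ∪ B) := disjoint_union_right.2 ⟨hDX, hDB⟩
    obtain ⟨A, hA, h1, h2, h3, -⟩ := exists_missing hDXB hxD (k := k)
      (by rw [card_union_of_disjoint hXB]; omega) (Z := ∅) (by simp; omega)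
    exact h3 (hx A (mem_starG.2 ⟨hA, Or.inr ⟨by rw [h1, card_singleton],
      subset_union_left.trans h2, Or.inl (subset_union_right.trans h2)⟩⟩))
  · obtain ⟨y, hy, hyx⟩ := exists_mem_ne hX x
    obtain ⟨A, hA, h1, h2⟩ := exists_superset_disjoint (T := Insert.insert y D) (Z := {x})
      (k := k) (by simp [hxD, hyx.symm]) ((card_insert_le _ _).trans (by omega))
      (by simp; omega)
    rw [insert_subset_iff] at h1
    exact (disjoint_singleton_right.1 h2) (hx A (mem_starG.2
      ⟨hA, Or.inl ⟨h1.2, Or.inl ⟨y, mem_inter.2 ⟨h1.1, hy⟩⟩⟩⟩))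

/-- As for H, with D ∪ B as a further hitting set. The test members miss u and contain exactly one
point b of B, namely one missed by the new set A. They meet A in d - 2 points if A contains D and
avoids X; if A misses some x ≠ u, they share no point of B with A. -/
theorem starG_isMaxNontrivial (hd : 3 ≤ d) (hD : D.card + 1 = d) (hDX : Disjoint D X)
    (hDB : Disjoint D B) (hXB : Disjoint X B) (hX : 2 ≤ X.card) (hB : B.card = 2) (huD : u ∈ D)
    (hc : d + X.card = k) (hkn : 2 * k + 2 < n) :
    IsMaxNontrivial k d (starG k D X B u) := by
  have hX0 : X.Nonempty := card_pos.1 (by omega)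
  have hB0 : B.Nonempty := card_pos.1 (by omega)
  have hnt := starG_not_isTrivial (k := k) (u := u) (by omega) hDX hDB hXB hX hB (by omega)
    (by omega)
  refine ⟨filter_subset _ _, (isDWiseIntersecting_iff (by omega)).2
    (starG_dwise hD huD hX0 hB0), hnt, ?_⟩
  intro A hA hcon
  rw [mem_sdiff, mem_kSubsets] at hA
  obtain ⟨hAk, hAn⟩ := hA
  rw [isDWiseIntersecting_iff (by omega)] at hcon
  set F := Insert.insert A (starG k D X B u) with hF
  have hsub : starG k D X B u ⊆ F := subset_insert _ _
  have hnt' := not_isTrivial_mono hsub hnt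
  have hu : F ⊆ kSubsets n k := insert_subset (mem_kSubsets.2 hAk) (filter_subset _ _)
  have hhit := hits_insert_of_meet (X := X) (by omega) hcon hu hD (by omega)
    fun B hB h1 h2 => hsub (mem_starG.2 ⟨hB, Or.inl ⟨h1, Or.inl h2⟩⟩)
  have hAF : A ∈ F := mem_insert_self _ _
  have hmiss : ∀ b ∈ B, b ∉ A → ∃ C ∈ F, C.card = k ∧ u ∉ C ∧ D.erase u ⊆ C ∧ b ∈ C ∧
      C ∩ (A ∪ B) ⊆ D.erase u ∪ Insert.insert b X := by
    intro b hb hbA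
    have hbX : b ∉ X := fun h => disjoint_left.1 hXB h hb
    have hDbX : Disjoint D (Insert.insert b X) := by
      rw [disjoint_insert_right]
      exact ⟨fun h => disjoint_left.1 hDB h hb, hDX⟩
    obtain ⟨C, hC, h1, h2, h3, h4, h5⟩ := exists_missing hDbX huD (k := k)
      (by rw [card_insert_of_notMem hbX]; omega) (Z := A ∪ B)
      (by have := card_union_le A B; omega)
    rw [insert_subset_iff] at h2
    exact ⟨C, hsub (mem_starG.2 ⟨hC, Or.inr ⟨by rw [h1, card_singleton], h2.2,
      Or.inr ⟨h3, b, mem_inter.2 ⟨h2.1, hb⟩⟩⟩⟩), hC, h3, h4, h2.1, h5⟩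
  by_cases hDA : D ⊆ A
  · by_cases hAX : (A ∩ X).Nonempty
    · exact hAn (mem_starG.2 ⟨hAk, Or.inl ⟨hDA, Or.inl hAX⟩⟩)
    by_cases hBA : B ⊆ A
    · exact hAn (mem_starG.2 ⟨hAk, Or.inl ⟨hDA, Or.inr hBA⟩⟩)
    obtain ⟨b, hb, hbA⟩ := not_subset.1 hBA
    obtain ⟨C, hCF, hC, h3, -, -, h5⟩ := hmiss b hb hbA
    have := (hits_of_mem hcon hAF).le_card_inter hcon hnt' hCF
    have h6 : A ∩ C ⊆ D.erase u := by
      intro y hy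
      rw [mem_inter] at hy
      rcases mem_union.1 (h5 (mem_inter.2 ⟨hy.2, mem_union_left _ hy.1⟩)) with h | h
      · exact h
      · rcases mem_insert.1 h with rfl | h
        · exact absurd hy.1 hbA
        · exact absurd ⟨y, mem_inter.2 ⟨hy.1, h⟩⟩ hAX
    have := card_le_card h6
    have := card_erase_add_one huD
    omega
  · obtain ⟨hcard, hXA⟩ := card_sdiff_eq_one_of_hits hcon hnt' hD hX0 hhit hAF hDA
    have hDBh : Hits d F (D ∪ B) := by
      refine hits_of_forall_superset (by omega) hcon hu (hB0.mono subset_union_right)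
        ((card_union_le _ _).trans (by omega)) fun C hC hs => ?_
      exact hsub (mem_starG.2 ⟨hC, Or.inl
        ⟨subset_union_left.trans hs, Or.inr (subset_union_right.trans hs)⟩⟩)
    by_cases hBA : B ⊆ A
    · exact hAn (mem_starG.2 ⟨hAk, Or.inr ⟨hcard, hXA, Or.inl hBA⟩⟩)
    have hAB : (A ∩ B).Nonempty := by
      have h1 := hDBh.le_card_inter hcon hnt' hAF
      rw [union_inter_distrib_right] at h1
      have h2 := card_union_le (D ∩ A) (B ∩ A)
      have h3 := card_sdiff_add_card_inter D A
      rw [inter_comm A B]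
      exact card_pos.1 (by omega)
    by_cases huA : u ∈ A
    swap
    · exact hAn (mem_starG.2 ⟨hAk, Or.inr ⟨hcard, hXA, Or.inr ⟨huA, hAB⟩⟩⟩)
    obtain ⟨b, hb, hbA⟩ := not_subset.1 hBA
    obtain ⟨C, hCF, hC, h3, -, -, h5⟩ := hmiss b hb hbA
    obtain ⟨x, hx⟩ : (D \ A).Nonempty := card_pos.1 (by omega)
    rw [mem_sdiff] at hx
    obtain ⟨z, hz, hzD, hzA, hzC⟩ := hDBh.exists_mem_two hnt' hD hAF hCF hx.1 huD hx.2 h3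
      (by rintro rfl; exact hx.2 huA)
    have hzB : z ∈ B := (mem_union.1 hz).resolve_left hzD
    rcases mem_union.1 (h5 (mem_inter.2 ⟨hzC, mem_union_right _ hzB⟩)) with h | h
    · exact hzD (mem_of_mem_erase h)
    · rcases mem_insert.1 h with rfl | h
      · exact hbA hzA
      · exact disjoint_left.1 hXB h hzB

end

/-! ### Hitting sets of size d: star or clique -/

section

variable {n k d : ℕ} {F : Finset (Finset (Fin n))} {D X T A B Y : Finset (Fin n)} {u : Fin n}

/-- A `d`-uniform family whose members pairwise share `d - 1` elements is a star or lives on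
`d + 1` points. -/
theorem star_or_clique {α : Type*} [DecidableEq α] {𝒯 : Finset (Finset α)}
    (hc : ∀ T ∈ 𝒯, T.card = d) (hp : ∀ T ∈ 𝒯, ∀ T' ∈ 𝒯, d ≤ (T ∩ T').card + 1)
    (h2 : 1 < 𝒯.card) :
    (∃ D, D.card + 1 = d ∧ ∀ T ∈ 𝒯, D ⊆ T) ∨ ∃ Y, Y.card = d + 1 ∧ ∀ T ∈ 𝒯, T ⊆ Y := by
  obtain ⟨T₁, h1, T₂, h2, hne⟩ := one_lt_card.1 h2
  have c1 := hc _ h1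
  have c2 := hc _ h2
  have c12 : (T₁ ∩ T₂).card + 1 = d := by
    have := hp _ h1 _ h2
    have hlt : (T₁ ∩ T₂).card < d := by
      by_contra! hge
      have e1 := eq_of_subset_of_card_le (inter_subset_left (s₁ := T₁) (s₂ := T₂)) (by omega)
      have e2 := eq_of_subset_of_card_le (inter_subset_right (s₁ := T₁) (s₂ := T₂)) (by omega)
      exact hne (e1.symm.trans e2)
    omega
  have cu := card_union_add_card_inter T₁ T₂
  by_cases hall : ∀ T ∈ 𝒯, T₁ ∩ T₂ ⊆ T
  · exact Or.inl ⟨_, c12, hall⟩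
  right
  push Not at hall
  obtain ⟨T₃, h3, hT3⟩ := hall
  refine ⟨T₁ ∪ T₂, by omega, fun T hT => ?_⟩
  -- A set T not inside T₁ ∪ T₂ has the same trace on T₁, on T₂ and on their union. As T₃ lies in
  -- the union, T ∩ T₃ is then contained in T₁ ∩ T₂ ∩ T₃, which is too small.
  have c3 : (T₁ ∩ T₂ ∩ T₃).card + 2 ≤ d := by
    have : (T₁ ∩ T₂ ∩ T₃).card < (T₁ ∩ T₂).card :=
      card_lt_card ⟨inter_subset_left, fun h => hT3 (h.trans inter_subset_right)⟩
    omega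
  by_contra hTY
  have hlt : (T ∩ (T₁ ∪ T₂)).card + 1 ≤ d := by
    rw [← hc T hT]
    exact card_lt_card ⟨inter_subset_left, fun h => hTY (h.trans inter_subset_right)⟩
  have e1 : T ∩ T₁ = T ∩ (T₁ ∪ T₂) := eq_of_subset_of_card_le
    (inter_subset_inter_left subset_union_left) (by have := hp _ hT _ h1; omega)
  have e2 : T ∩ T₂ = T ∩ (T₁ ∪ T₂) := eq_of_subset_of_card_le
    (inter_subset_inter_left subset_union_right) (by have := hp _ hT _ h2; omega)
  -- `T₃` is contained in the union as well
  have h3Y : T₃ ⊆ T₁ ∪ T₂ := by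
    have i1 := hp _ h3 _ h1
    have i2 := hp _ h3 _ h2
    have i3 := card_union_add_card_inter (T₃ ∩ T₁) (T₃ ∩ T₂)
    have i4 : T₃ ∩ T₁ ∩ (T₃ ∩ T₂) = T₁ ∩ T₂ ∩ T₃ := by ext; simp; tauto
    rw [i4, ← inter_union_distrib_left] at i3
    have i5 : T₃ ∩ (T₁ ∪ T₂) = T₃ :=
      eq_of_subset_of_card_le inter_subset_left (by rw [hc _ h3]; omega)
    exact inter_eq_left.1 i5
  have hsub : T ∩ T₃ ⊆ T₁ ∩ T₂ ∩ T₃ := by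
    intro x hx
    rw [mem_inter] at hx
    have hx' : x ∈ T ∩ (T₁ ∪ T₂) := mem_inter.2 ⟨hx.1, h3Y hx.2⟩
    have a1 := hx'
    rw [← e1, mem_inter] at a1
    rw [← e2, mem_inter] at hx'
    exact mem_inter.2 ⟨mem_inter.2 ⟨a1.2, hx'.2⟩, hx.2⟩
  have := card_le_card hsub
  have := hp _ hT _ h3
  omega

open Classical in
/-- The hitting sets of size `d`. -/
noncomputable def gens (d : ℕ) (F : Finset (Finset (Fin n))) : Finset (Finset (Fin n)) :=
  univ.filter fun T => T.card = d ∧ Hits d F T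

theorem mem_gens : T ∈ gens d F ↔ T.card = d ∧ Hits d F T := by simp [gens]

/-- Some k-superset of T avoids T' \ T. It is a member, so T' meets it in at least d - 1 points, all
of which lie in T. -/
theorem le_card_inter_of_hits (hF : IsMaxNontrivial k d F) (hkn : d + k ≤ n) (hn : 0 < n)
    (hdk : d ≤ k) {T' : Finset (Fin n)} (hT : T ∈ gens d F) (hT' : T' ∈ gens d F) :
    d ≤ (T ∩ T').card + 1 := by
  rw [mem_gens] at hT hT'
  obtain ⟨A, hA, h1, h2⟩ := exists_superset_disjoint (T := T) (Z := T' \ T) (k := k)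
    disjoint_sdiff (by omega) (by have := card_le_card (sdiff_subset (s := T') (t := T)); omega)
  have h3 := hT'.2.le_card_inter (hF.dwise hn) hF.nontrivial (hT.2.mem_of_superset hn hF h1 hA)
  refine h3.trans (Nat.succ_le_succ (card_le_card fun x hx => ?_))
  rw [mem_inter] at hx ⊢
  refine ⟨?_, hx.1⟩
  by_contra hxT
  exact disjoint_left.1 h2 hx.2 (mem_sdiff.2 ⟨hx.1, hxT⟩)

/-- If at least three minimal hitting sets lie in a `(d + 1)`-set, the family is `H` with two
elements. -/
theorem eq_starH_of_gens_subset (hF : IsMaxNontrivial k d F) (hn : 0 < n) (hd : 0 < d)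
    (hY : Y.card = d + 1) (hg : 3 ≤ (gens d F).card) (hgY : ∀ T ∈ gens d F, T ⊆ Y) :
    ∃ D X : Finset (Fin n), D.card + 1 = d ∧ Disjoint D X ∧ X.card = 2 ∧ F = starH k D X := by
  obtain ⟨T₀, hT₀⟩ : (gens d F).Nonempty := card_pos.1 (by omega)
  -- Otherwise A ∩ Y has d - 1 points and every generator is A ∩ Y plus one of the two points of Y \
  -- A, which allows only two generators.
  have hbig : ∀ A ∈ F, d ≤ (A ∩ Y).card := by
    intro A hA
    by_contra! hlt
    have hsub : gens d F ⊆ (Y \ A).image fun y => Insert.insert y (A ∩ Y) := by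
      intro T hT
      have h1 := (mem_gens.1 hT).2.le_card_inter (hF.dwise hn) hF.nontrivial hA
      have h2 : T ∩ A = A ∩ Y := by
        refine eq_of_subset_of_card_le (fun x hx => ?_) (by omega)
        rw [mem_inter] at hx
        exact mem_inter.2 ⟨hx.2, hgY T hT hx.1⟩
      have h3 := card_sdiff_add_card_inter T A
      rw [(mem_gens.1 hT).1, h2] at h3
      rw [h2] at h1
      obtain ⟨y, hy⟩ := card_eq_one.1 (by omega : (T \ A).card = 1)
      have hyT : y ∈ T \ A := by rw [hy]; exact mem_singleton_self y
      rw [mem_sdiff] at hyT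
      refine mem_image.2 ⟨y, mem_sdiff.2 ⟨hgY T hT hyT.1, hyT.2⟩, ?_⟩
      rw [← h2, insert_eq, ← hy, sdiff_union_inter]
    have h1 := (card_le_card hsub).trans card_image_le
    have h2 := card_sdiff_add_card_inter Y A
    have h3 := (mem_gens.1 hT₀).2.le_card_inter (hF.dwise hn) hF.nontrivial hA
    have h4 : (T₀ ∩ A).card ≤ (Y ∩ A).card := card_le_card (inter_subset_inter_right (hgY _ hT₀))
    omega
  -- Any pair X serves: with |X| = 2, H consists of the k-sets missing at most one point of Y = D ∪
  -- X.
  obtain ⟨X, hXY, hX⟩ := exists_subset_card_eq (s := Y) (n := 2) (by omega)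
  have hDc : (Y \ X).card + 1 = d := by rw [card_sdiff_of_subset hXY]; omega
  refine ⟨Y \ X, X, hDc, sdiff_disjoint, hX, ?_⟩
  refine hF.eq_of_subset (fun A hA => ?_) (filter_subset _ _) ((isDWiseIntersecting_iff hn).2
    (starH_dwise hDc (card_pos.1 (by omega))))
  refine mem_starH.2 ⟨hF.card_eq hA, ?_⟩
  have h1 := hbig A hA
  have h2 := card_sdiff_add_card_inter Y A
  rw [inter_comm] at h2
  have h3 : (Y \ A).card ≤ 1 := by omega
  by_cases hDA : Y \ X ⊆ A
  · left
    refine ⟨hDA, ?_⟩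
    by_contra hAX
    have : X ⊆ Y \ A := fun x hx => mem_sdiff.2
      ⟨hXY hx, fun hxA => hAX ⟨x, mem_inter.2 ⟨hxA, hx⟩⟩⟩
    have := card_le_card this
    omega
  · right
    obtain ⟨x, hx, hxA⟩ := not_subset.1 hDA
    have hxY := mem_sdiff.1 hx
    have hle : ∀ y ∈ Y, y ∉ A → y = x := fun y hy hyA =>
      card_le_one.1 h3 y (mem_sdiff.2 ⟨hy, hyA⟩) x (mem_sdiff.2 ⟨hxY.1, hxA⟩)
    refine ⟨card_eq_one.2 ⟨x, ?_⟩, fun y hy => ?_⟩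
    · ext y
      simp only [mem_sdiff, mem_singleton]
      constructor
      · rintro ⟨⟨hy, -⟩, hyA⟩
        exact hle y hy hyA
      · rintro rfl
        exact ⟨hxY, hxA⟩
    · by_contra hyA
      exact hxY.2 (hle y (hXY hy) hyA ▸ hy)

/-- `D` is a common `(d - 1)`-subset of the minimal hitting sets, which are the `D ∪ {x}` with
`x ∈ X`. -/
structure IsCore (d : ℕ) (F : Finset (Finset (Fin n))) (D X : Finset (Fin n)) : Prop where
  card_add_one : D.card + 1 = d
  disjoint : Disjoint D X
  nonempty : X.Nonempty
  mem_iff : ∀ x ∉ D, x ∈ X ↔ Hits d F (Insert.insert x D)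

theorem exists_isCore (hD : D.card + 1 = d) (hg : (gens d F).Nonempty)
    (hgD : ∀ T ∈ gens d F, D ⊆ T) : ∃ X, IsCore d F D X ∧ X.card = (gens d F).card := by
  classical
  set X : Finset (Fin n) := univ.filter fun x => x ∉ D ∧ Hits d F (Insert.insert x D) with hX
  have himg : gens d F = X.image fun x => Insert.insert x D := by
    ext T
    simp only [mem_image, hX, mem_filter, mem_univ, true_and]
    constructor
    · intro hT
      have h1 := card_sdiff_of_subset (hgD T hT)
      rw [(mem_gens.1 hT).1] at h1
      obtain ⟨x, hx⟩ := card_eq_one.1 (by omega : (T \ D).card = 1)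
      have hxT : x ∈ T \ D := by rw [hx]; exact mem_singleton_self x
      have hTe : Insert.insert x D = T := by
        rw [insert_eq, ← hx, sdiff_union_of_subset (hgD T hT)]
      exact ⟨x, ⟨(mem_sdiff.1 hxT).2, hTe ▸ (mem_gens.1 hT).2⟩, hTe⟩
    · rintro ⟨x, ⟨hx, hh⟩, rfl⟩
      exact mem_gens.2 ⟨by rw [card_insert_of_notMem hx]; exact hD, hh⟩
  have hinj : Set.InjOn (fun x => Insert.insert x D) (X : Set (Fin n)) := by
    intro x hx y hy hxy
    have hxD : x ∉ D := (mem_filter.1 hx).2.1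
    have : x ∈ Insert.insert y D := by
      have h : Insert.insert x D = Insert.insert y D := hxy
      rw [← h]; exact mem_insert_self x D
    exact (mem_insert.1 this).resolve_right hxD
  have hcard : X.card = (gens d F).card := by rw [himg, card_image_of_injOn hinj]
  refine ⟨X, ⟨hD, ?_, card_pos.1 (by rw [hcard]; exact card_pos.2 hg), ?_⟩, hcard⟩
  · exact disjoint_left.2 fun x hx hxX => (mem_filter.1 hxX).2.1 hx
  · intro x hx
    simp [hX, hx]

/-! ### Structure of a family with a core -/

namespace IsCore

theorem miss (hC : IsCore d F D X) (hF : IsMaxNontrivial k d F) (hn : 0 < n) (hA : A ∈ F)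
    (hDA : ¬ D ⊆ A) : (D \ A).card = 1 ∧ X ⊆ A :=
  card_sdiff_eq_one_of_hits (hF.dwise hn) hF.nontrivial hC.card_add_one hC.nonempty
    (fun x hx => (hC.mem_iff x (disjoint_right.1 hC.disjoint hx)).1 hx) hA hDA

/-- A member not containing D misses only one point of D, so the d - 1 points of D need d - 1
different members of S. No place is left for a member containing D. -/
theorem exists_notMem_of_common (hC : IsCore d F D X) (hF : IsMaxNontrivial k d F) (hn : 0 < n)
    {S : Finset (Finset (Fin n))} (hS : S ⊆ F) (hc : S.card + 1 ≤ d)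
    (hSD : ∀ x ∈ D, ∃ A ∈ S, x ∉ A) : ∀ A ∈ S, ¬ D ⊆ A := by
  intro A hA hDA
  choose! B hB using hSD
  have hinj : Set.InjOn B D := by
    intro x hx y hy hxy
    have hy' := (hB y hy).2
    rw [← hxy] at hy'
    exact eq_of_card_sdiff_eq_one
      (hC.miss hF hn (hS (hB x hx).1) fun hsub => (hB x hx).2 (hsub hx)).1 hx (hB x hx).2 hy hy'
  have hAi : A ∉ D.image B := by
    intro hmem
    obtain ⟨x, hx, rfl⟩ := mem_image.1 hmem
    exact (hB x hx).2 (hDA hx)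
  have h1 := card_le_card (insert_subset hA (image_subset_iff.2 fun x hx => (hB x hx).1))
  rw [card_insert_of_notMem hAi, card_image_of_injOn hinj] at h1
  have := hC.card_add_one
  omega

/-- D ∪ {y} could fail to hit only those S whose common part avoids D, and such S consist of members
not containing D. This identifies X from outside and is how contradictions with the choice of X
arise. -/
theorem mem_of_forall (hC : IsCore d F D X) (hF : IsMaxNontrivial k d F) (hn : 0 < n)
    {y : Fin n} (hyD : y ∉ D) (hy : ∀ A ∈ F, ¬ D ⊆ A → y ∈ A) : y ∈ X := by
  rw [hC.mem_iff y hyD]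
  intro S hS hc
  by_cases hSD : ∃ x ∈ D, ∀ A ∈ S, x ∈ A
  · obtain ⟨x, hx, h⟩ := hSD
    exact ⟨x, mem_insert_of_mem hx, h⟩
  · push Not at hSD
    exact ⟨y, mem_insert_self _ _, fun A hA =>
      hy A (hS hA) (hC.exists_notMem_of_common hF hn hS hc hSD A hA)⟩

theorem card_residue (hC : IsCore d F D X) (hF : IsMaxNontrivial k d F) (hn : 0 < n) (hA : A ∈ F)
    (hDA : ¬ D ⊆ A) : (A \ (D ∪ X)).card + d + X.card = k + 2 := by
  obtain ⟨h1, h2⟩ := hC.miss hF hn hA hDA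
  have h3 := card_sdiff_add_card_inter A (D ∪ X)
  have h4 := card_sdiff_add_card_inter D A
  have h5 : A ∩ (D ∪ X) = (D ∩ A) ∪ X := by
    rw [inter_union_distrib_left, inter_eq_right.2 h2, inter_comm]
  rw [h5, card_union_of_disjoint (hC.disjoint.mono_left inter_subset_left), hF.card_eq hA] at h3
  have := hC.card_add_one
  omega

theorem exists_miss_ne (hC : IsCore d F D X) (hF : IsMaxNontrivial k d F) (hd : 3 ≤ d)
    (x : Fin n) : ∃ y ∈ D, y ≠ x ∧ ∃ A ∈ F, y ∉ A := by
  obtain ⟨y, hy, hyx⟩ := exists_mem_ne (s := D) (by have := hC.card_add_one; omega) x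
  exact ⟨y, hy, hyx, exists_notMem_of_not_isTrivial hF.nontrivial y⟩

/-- Members not containing D have at most one point outside D ∪ X. If A contains D and avoids X,
then two members missing different points of D share such a point. Comparing with two fixed members
shows that it is one point z for all of them, and then z belongs to X. -/
theorem eq_starH (hC : IsCore d F D X) (hF : IsMaxNontrivial k d F) (hn : 0 < n) (hd : 3 ≤ d)
    (hX : k + 1 ≤ d + X.card) : F = starH k D X := by
  refine hF.eq_of_subset (fun A hA => mem_starH.2 ⟨hF.card_eq hA, ?_⟩) (filter_subset _ _)
    ((isDWiseIntersecting_iff hn).2 (starH_dwise hC.card_add_one hC.nonempty))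
  by_cases hDA : D ⊆ A
  swap
  · exact Or.inr (hC.miss hF hn hA hDA)
  refine Or.inl ⟨hDA, ?_⟩
  by_contra hAX
  have htwo : ∀ A₁ ∈ F, ∀ A₂ ∈ F, ∀ x₁ ∈ D, ∀ x₂ ∈ D, x₁ ∉ A₁ → x₂ ∉ A₂ → x₁ ≠ x₂ →
      ∃ z ∈ A, z ∈ A₁ \ (D ∪ X) ∧ z ∈ A₂ := by
    intro A₁ h1 A₂ h2 x₁ hx1 x₂ hx2 hn1 hn2 hne
    obtain ⟨z, hz, hzD, hz1, hz2⟩ := (hits_of_mem (hF.dwise hn) hA).exists_mem_two hF.nontrivial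
      hC.card_add_one h1 h2 hx1 hx2 hn1 hn2 hne
    refine ⟨z, hz, mem_sdiff.2 ⟨hz1, ?_⟩, hz2⟩
    rw [mem_union, not_or]
    exact ⟨hzD, fun hzX => hAX ⟨z, mem_inter.2 ⟨hz, hzX⟩⟩⟩
  have hone : ∀ A₁ ∈ F, ¬ D ⊆ A₁ → ∀ z ∈ A₁ \ (D ∪ X), ∀ z' ∈ A₁ \ (D ∪ X), z = z' := by
    intro A₁ h1 hD1
    have := hC.card_residue hF hn h1 hD1
    exact card_le_one.1 (by omega)
  obtain ⟨x₁, hx1⟩ : D.Nonempty := card_pos.1 (by have := hC.card_add_one; omega)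
  obtain ⟨A₁, h1, hn1⟩ := exists_notMem_of_not_isTrivial hF.nontrivial x₁
  obtain ⟨x₂, hx2, hne, A₂, h2, hn2⟩ := hC.exists_miss_ne hF hd x₁
  obtain ⟨z, hzA, hz1, hz2⟩ := htwo A₁ h1 A₂ h2 x₁ hx1 x₂ hx2 hn1 hn2 hne.symm
  have hz2' : z ∈ A₂ \ (D ∪ X) := mem_sdiff.2 ⟨hz2, (mem_sdiff.1 hz1).2⟩
  have hzDX := (mem_sdiff.1 hz1).2
  rw [mem_union, not_or] at hzDX
  refine hzDX.2 (hC.mem_of_forall hF hn hzDX.1 fun A₃ h3 hD3 => ?_)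
  obtain ⟨x₃, hx3, hn3⟩ := not_subset.1 hD3
  -- The shared point needs two different missed points of D, so A₃ is compared with A₂ when it
  -- misses the same point as A₁.
  by_cases h13 : x₁ = x₃
  · obtain ⟨z', -, hz', hz3⟩ := htwo A₂ h2 A₃ h3 x₂ hx2 x₃ hx3 hn2 hn3 (h13 ▸ hne)
    rwa [hone A₂ h2 (fun h => hn2 (h hx2)) z hz2' z' hz']
  · obtain ⟨z', -, hz', hz3⟩ := htwo A₁ h1 A₃ h3 x₁ hx1 x₃ hx3 hn1 hn3 h13
    rwa [hone A₁ h1 (fun h => hn1 (h hx1)) z hz1 z' hz']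

/-- Neither point of B = {a, b} is in X, so some A₁ not containing D omits a and some A₂ not
containing D omits b. Members missing different points of D share a or b, so A₁ and A₂ miss the same
point, which is u; members missing another point of D contain both a and b. -/
theorem eq_starG (hC : IsCore d F D X) (hF : IsMaxNontrivial k d F) (hn : 0 < n) (hd : 3 ≤ d)
    (hX : d + X.card = k) (hB : B.card = 2) (hDB : Disjoint D B) (hXB : Disjoint X B)
    (hDBh : Hits d F (D ∪ B)) : ∃ u ∈ D, F = starG k D X B u := by
  have hB0 : B.Nonempty := card_pos.1 (by omega)
  obtain ⟨a, b, hab, rfl⟩ := card_eq_two.1 hB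
  simp only [disjoint_insert_right, disjoint_singleton_right] at hDB hXB
  -- members missing different elements of `D` share one of `a`, `b`
  have htwo : ∀ A₁ ∈ F, ∀ A₂ ∈ F, ∀ x₁ ∈ D, ∀ x₂ ∈ D, x₁ ∉ A₁ → x₂ ∉ A₂ → x₁ ≠ x₂ →
      (a ∈ A₁ ∧ a ∈ A₂) ∨ (b ∈ A₁ ∧ b ∈ A₂) := by
    intro A₁ h1 A₂ h2 x₁ hx1 x₂ hx2 hn1 hn2 hne
    obtain ⟨z, hz, hzD, hz1, hz2⟩ := hDBh.exists_mem_two hF.nontrivial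
      hC.card_add_one h1 h2 hx1 hx2 hn1 hn2 hne
    have hz' := (mem_union.1 hz).resolve_left hzD
    simp only [mem_insert, mem_singleton] at hz'
    rcases hz' with rfl | rfl
    · exact Or.inl ⟨hz1, hz2⟩
    · exact Or.inr ⟨hz1, hz2⟩
  have hex : ∀ y, y ∉ D → y ∉ X → ∃ A ∈ F, y ∉ A ∧ ∃ x ∈ D, x ∉ A := by
    intro y hyD hyX
    by_contra! hcon
    refine hyX (hC.mem_of_forall hF hn hyD fun A hA hDA => ?_)
    by_contra hyA
    exact hDA (hcon A hA hyA)
  obtain ⟨A₁, h1, ha1, x₁, hx1, hn1⟩ := hex a hDB.1 hXB.1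
  obtain ⟨A₂, h2, hb2, x₂, hx2, hn2⟩ := hex b hDB.2 hXB.2
  have hx12 : x₁ = x₂ := by
    by_contra hne
    rcases htwo A₁ h1 A₂ h2 x₁ hx1 x₂ hx2 hn1 hn2 hne with h | h
    · exact ha1 h.1
    · exact hb2 h.2
  subst hx12
  have hboth : ∀ A ∈ F, ∀ x ∈ D, x ∉ A → x ≠ x₁ → a ∈ A ∧ b ∈ A := by
    intro A hA x hx hxA hne
    have e1 := htwo A₁ h1 A hA x₁ hx1 x hx hn1 hxA hne.symm
    have e2 := htwo A₂ h2 A hA x₁ hx1 x hx hn2 hxA hne.symm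
    tauto
  obtain ⟨x₃, hx3, hne, A₃, h3, hn3⟩ := hC.exists_miss_ne hF hd x₁
  have hb1 : b ∈ A₁ := by
    rcases htwo A₁ h1 A₃ h3 x₁ hx1 x₃ hx3 hn1 hn3 hne.symm with h | h
    · exact absurd h.1 ha1
    · exact h.1
  have ha2 : a ∈ A₂ := by
    rcases htwo A₂ h2 A₃ h3 x₁ hx1 x₃ hx3 hn2 hn3 hne.symm with h | h
    · exact h.1
    · exact absurd h.1 hb2
  obtain ⟨ha3, hb3⟩ := hboth A₃ h3 x₃ hx3 hn3 hne
  refine ⟨x₁, hx1, hF.eq_of_subset (fun A hA => mem_starG.2 ⟨hF.card_eq hA, ?_⟩)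
    (filter_subset _ _)
    ((isDWiseIntersecting_iff hn).2 (starG_dwise hC.card_add_one hx1 hC.nonempty hB0))⟩
  by_cases hDA : D ⊆ A
  · refine Or.inl ⟨hDA, ?_⟩
    by_cases hAX : (A ∩ X).Nonempty
    · exact Or.inl hAX
    right
    -- the residue of `A₃` is exactly `{a, b}`
    have hres : A₃ \ (D ∪ X) = {a, b} := by
      refine (eq_of_subset_of_card_le ?_ ?_).symm
      · intro z hz
        simp only [mem_insert, mem_singleton] at hz
        rw [mem_sdiff, mem_union, not_or]
        rcases hz with rfl | rfl
        · exact ⟨ha3, hDB.1, hXB.1⟩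
        · exact ⟨hb3, hDB.2, hXB.2⟩
      · have := hC.card_residue hF hn h3 fun h => hn3 (h hx3)
        omega
    have hget : ∀ A' ∈ F, x₁ ∉ A' → ∃ z ∈ A, z ∈ A' ∧ (z = a ∨ z = b) := by
      intro A' h' hn'
      obtain ⟨z, hz, hzD, hz1, hz2⟩ := (hits_of_mem (hF.dwise hn) hA).exists_mem_two
        hF.nontrivial hC.card_add_one h' h3 hx1 hx3 hn' hn3 hne.symm
      have hz' : z ∈ A₃ \ (D ∪ X) := by
        rw [mem_sdiff, mem_union, not_or]
        exact ⟨hz2, hzD, fun hzX => hAX ⟨z, mem_inter.2 ⟨hz, hzX⟩⟩⟩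
      rw [hres, mem_insert, mem_singleton] at hz'
      exact ⟨z, hz, hz1, hz'⟩
    obtain ⟨z, hz, hz1, hz'⟩ := hget A₁ h1 hn1
    obtain ⟨w, hw, hw1, hw'⟩ := hget A₂ h2 hn2
    have hbA : b ∈ A := by
      rcases hz' with rfl | rfl
      · exact absurd hz1 ha1
      · exact hz
    have haA : a ∈ A := by
      rcases hw' with rfl | rfl
      · exact hw
      · exact absurd hw1 hb2
    simp [insert_subset_iff, haA, hbA]
  · obtain ⟨hcard, hXA⟩ := hC.miss hF hn hA hDA
    refine Or.inr ⟨hcard, hXA, ?_⟩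
    obtain ⟨x, hx, hxA⟩ := not_subset.1 hDA
    by_cases hxx : x = x₁
    · subst hxx
      refine Or.inr ⟨hxA, ?_⟩
      rcases htwo A hA A₃ h3 x hx1 x₃ hx3 hxA hn3 hne.symm with h | h
      · exact ⟨a, by simp [h.1]⟩
      · exact ⟨b, by simp [h.1]⟩
    · left
      obtain ⟨haA, hbA⟩ := hboth A hA x hx hxA hxx
      simp [insert_subset_iff, haA, hbA]

end IsCore

end

/-! ### Counting members -/

section

variable {n k d : ℕ} {F : Finset (Finset (Fin n))} {D X T A B Y : Finset (Fin n)} {u : Fin n}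

theorem card_filter_subset_disjoint {Z : Finset (Fin n)} (hTZ : Disjoint T Z) (hT : T.card ≤ k) :
    ((kSubsets n k).filter fun A => T ⊆ A ∧ Disjoint A Z).card =
      (n - T.card - Z.card).choose (k - T.card) := by
  have h1 : (univ \ (T ∪ Z)).card = n - T.card - Z.card := by
    rw [card_sdiff_of_subset (subset_univ _), card_union_of_disjoint hTZ, card_univ,
      Fintype.card_fin, Nat.sub_sub]
  rw [← h1, ← card_powersetCard]
  refine card_nbij' (fun A => A \ T) (fun A => A ∪ T) ?_ ?_ ?_ ?_
  · intro A hA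
    simp only [coe_filter, mem_kSubsets, Set.mem_ofPred_eq] at hA
    obtain ⟨hA, hTA, hAZ⟩ := hA
    rw [mem_coe, mem_powersetCard, card_sdiff_of_subset hTA, hA]
    refine ⟨fun x hx => ?_, rfl⟩
    rw [mem_sdiff] at hx
    simp only [mem_sdiff, mem_univ, mem_union, true_and, not_or]
    exact ⟨hx.2, disjoint_left.1 hAZ hx.1⟩
  · intro A hA
    rw [mem_coe, mem_powersetCard] at hA
    have hAT : Disjoint A T := disjoint_left.2 fun x hx hxT =>
      (mem_sdiff.1 (hA.1 hx)).2 (mem_union_left _ hxT)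
    have hAZ : Disjoint A Z := disjoint_left.2 fun x hx hxT =>
      (mem_sdiff.1 (hA.1 hx)).2 (mem_union_right _ hxT)
    simp only [coe_filter, mem_kSubsets, Set.mem_ofPred_eq]
    refine ⟨?_, subset_union_right, disjoint_union_left.2 ⟨hAZ, hTZ⟩⟩
    rw [card_union_of_disjoint hAT, hA.2]
    omega
  · intro A hA
    simp only [coe_filter, mem_kSubsets, Set.mem_ofPred_eq] at hA
    exact sdiff_union_of_subset hA.2.1
  · intro A hA
    rw [mem_coe, mem_powersetCard] at hA
    have hAT : Disjoint A T := disjoint_left.2 fun x hx hxT =>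
      (mem_sdiff.1 (hA.1 hx)).2 (mem_union_left _ hxT)
    exact union_sdiff_cancel_right hAT

theorem card_filter_subset (hT : T.card ≤ k) :
    ((kSubsets n k).filter fun A => T ⊆ A).card = (n - T.card).choose (k - T.card) := by
  have h := card_filter_subset_disjoint (n := n) (disjoint_empty_right T) hT
  simpa using h

/-- Branching: if partial sets of size less than `s` can always be extended in at most `q` ways,
there are at most `q ^ s'` supersets of size `s` to consider. -/
theorem card_filter_le_pow_mul_choose {𝒢 : Finset (Finset (Fin n))} (h𝒢 : 𝒢 ⊆ kSubsets n k)
    {q s : ℕ} (hs : s ≤ k) {T₀ : Finset (Fin n)}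
    (h : ∀ T, T₀ ⊆ T → T.card < s → (∃ A ∈ 𝒢, T ⊆ A) →
      ∃ J : Finset (Fin n), J.card ≤ q ∧ Disjoint J T ∧ ∀ A ∈ 𝒢, T ⊆ A → (A ∩ J).Nonempty) :
    ∀ m, ∀ T, T₀ ⊆ T → T.card + m = s →
      (𝒢.filter fun A => T ⊆ A).card ≤ q ^ m * (n - s).choose (k - s) := by
  intro m
  induction m with
  | zero =>
    intro T _ hc
    rw [pow_zero, one_mul]
    have hc' : T.card = s := hc
    rw [← hc', ← card_filter_subset (n := n) (k := k) (T := T) (by omega)]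
    exact card_le_card (filter_subset_filter _ h𝒢)
  | succ m ih =>
    intro T hT hc
    by_cases hex : ∃ A ∈ 𝒢, T ⊆ A
    swap
    · rw [filter_eq_empty_iff.2 fun A hA hTA => hex ⟨A, hA, hTA⟩]
      simp
    obtain ⟨J, hJ, hJT, hJA⟩ := h T hT (by omega) hex
    have hsub : (𝒢.filter fun A => T ⊆ A) ⊆
        J.biUnion fun j => 𝒢.filter fun A => Insert.insert j T ⊆ A := by
      intro A hA
      rw [mem_filter] at hA
      obtain ⟨j, hj⟩ := hJA A hA.1 hA.2
      rw [mem_inter] at hj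
      exact mem_biUnion.2 ⟨j, hj.2, mem_filter.2 ⟨hA.1, insert_subset hj.1 hA.2⟩⟩
    calc _ ≤ _ := card_le_card hsub
      _ ≤ J.card * (q ^ m * (n - s).choose (k - s)) := by
        refine card_biUnion_le_card_mul _ _ _ fun j hj => ih _ (hT.trans (subset_insert _ _)) ?_
        rw [card_insert_of_notMem (disjoint_left.1 hJT hj)]
        omega
      _ ≤ q * (q ^ m * (n - s).choose (k - s)) := Nat.mul_le_mul_right _ hJ
      _ = _ := by rw [pow_succ']; ring

/-- A set which is not hitting is avoided by the common part of at least one and at most `d - 1`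
members. -/
theorem exists_common_of_not_hits (hd : 2 ≤ d) (hnt : ¬ IsTrivial F) (hn : 0 < n)
    (hT : ¬ Hits d F T) : ∃ S ⊆ F, S.card + 1 ≤ d ∧ S.Nonempty ∧
      Disjoint (univ.filter fun x => ∀ A ∈ S, x ∈ A) T := by
  simp only [Hits, not_forall] at hT
  obtain ⟨S, hS, hc, h⟩ := hT
  rcases S.eq_empty_or_nonempty with rfl | hne
  · obtain ⟨A, hA, -⟩ := exists_notMem_of_not_isTrivial hnt ⟨0, hn⟩
    refine ⟨{A}, singleton_subset_iff.2 hA, by simpa using hd, singleton_nonempty _, ?_⟩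
    refine disjoint_right.2 fun x hx _ => h ⟨x, hx, by simp⟩
  · exact ⟨S, hS, hc, hne, disjoint_right.2 fun x hx hx' => h ⟨x, hx, (mem_filter.1 hx').2⟩⟩

/-- The size of a family up to lower order terms. -/
theorem IsMaxNontrivial.card_le (hF : IsMaxNontrivial k d F) (hn : 0 < n) (hd : 2 ≤ d)
    (hdk : d + 1 ≤ k) : F.card ≤ (gens d F).card * (n - d).choose (k - d) +
      k ^ (d + 1) * (n - (d + 1)).choose (k - (d + 1)) := by
  set 𝒢 := F.filter fun A => ∀ T ∈ gens d F, ¬ T ⊆ A with h𝒢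
  have hsplit : F ⊆ (gens d F).biUnion (fun T => (kSubsets n k).filter fun A => T ⊆ A) ∪ 𝒢 := by
    intro A hA
    by_cases h : ∃ T ∈ gens d F, T ⊆ A
    · obtain ⟨T, hT, hTA⟩ := h
      exact mem_union_left _ (mem_biUnion.2 ⟨T, hT, mem_filter.2 ⟨hF.uniform hA, hTA⟩⟩)
    · push Not at h
      exact mem_union_right _ (mem_filter.2 ⟨hA, h⟩)
  have h1 : ((gens d F).biUnion (fun T => (kSubsets n k).filter fun A => T ⊆ A)).card ≤
      (gens d F).card * (n - d).choose (k - d) := by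
    refine card_biUnion_le_card_mul _ _ _ fun T hT => ?_
    have hTd := (mem_gens.1 hT).1
    rw [card_filter_subset (by omega), hTd]
  have h2 : 𝒢.card ≤ k ^ (d + 1) * (n - (d + 1)).choose (k - (d + 1)) := by
    -- Branching from ∅ to size d + 1. A set of at most d points inside a member of 𝒢 is not
    -- hitting, so the common part of some members avoids it. That part has at most k points and
    -- meets every member of 𝒢.
    have h := card_filter_le_pow_mul_choose (n := n) (k := k) (𝒢 := 𝒢) (q := k) (s := d + 1)
      ((filter_subset _ _).trans hF.uniform) hdk (T₀ := ∅) ?_ (d + 1) ∅ (empty_subset _) (by simp)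
    · simpa using h
    · rintro T - hTd ⟨A, hA, hTA⟩
      have hTn : ¬ Hits d F T := by
        intro hT
        have := hT.le_card hd (hF.dwise hn) hF.nontrivial
        exact (mem_filter.1 hA).2 T (mem_gens.2 ⟨by omega, hT⟩) hTA
      obtain ⟨S, hS, hc, ⟨C, hC⟩, hdis⟩ := exists_common_of_not_hits hd hF.nontrivial hn hTn
      refine ⟨_, ?_, hdis, fun A hA _ => ?_⟩
      · rw [← hF.card_eq (hS hC)]
        exact card_le_card fun x hx => (mem_filter.1 hx).2 C hC
      · obtain ⟨x, hx, h⟩ := hits_of_mem (hF.dwise hn) (mem_filter.1 hA).1 S hS hc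
        exact ⟨x, mem_inter.2 ⟨hx, mem_filter.2 ⟨mem_univ _, h⟩⟩⟩
  calc F.card ≤ _ := card_le_card hsplit
    _ ≤ _ := card_union_le _ _
    _ ≤ _ := Nat.add_le_add h1 h2

/-- The members containing `D` and avoiding `X` in the case `|X| = k - d`. -/
theorem IsCore.eq_starG_or_card_le (hC : IsCore d F D X) (hF : IsMaxNontrivial k d F)
    (hn : 0 < n) (hd : 3 ≤ d) (hX : d + X.card = k) (hdk : d + 2 ≤ k) :
    (∃ B : Finset (Fin n), ∃ u ∈ D, B.card = 2 ∧ Disjoint D B ∧ Disjoint X B ∧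
      F = starG k D X B u) ∨
    (F.filter fun A => D ⊆ A ∧ ¬ (A ∩ X).Nonempty).card ≤
      8 * (n - (d + 2)).choose (k - (d + 2)) := by
  have hDc := hC.card_add_one
  by_cases hB : ∃ B : Finset (Fin n), B.card = 2 ∧ Disjoint D B ∧ Disjoint X B ∧ Hits d F (D ∪ B)
  · obtain ⟨B, hB, hDB, hXB, hh⟩ := hB
    obtain ⟨u, hu, h⟩ := hC.eq_starG hF hn hd hX hB hDB hXB hh
    exact Or.inl ⟨B, u, hu, hB, hDB, hXB, h⟩
  right
  set 𝒢 := F.filter fun A => ¬ (A ∩ X).Nonempty with h𝒢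
  -- Three steps lead from |D| = d - 1 to d + 2. Each has at most two choices, because the branching
  -- set lies in the two points that a member not containing D has outside D ∪ X; hence 8 = 2³. A
  -- hitting set of size d on the way would enlarge X, and one of size d + 1 would supply B.
  have h := card_filter_le_pow_mul_choose (n := n) (k := k) (𝒢 := 𝒢) (q := 2) (s := d + 2)
    ((filter_subset _ _).trans hF.uniform) hdk (T₀ := D) ?_ 3 D Subset.rfl (by omega)
  · refine (card_le_card fun A hA => ?_).trans h
    rw [mem_filter] at hA
    exact mem_filter.2 ⟨mem_filter.2 ⟨hA.1, hA.2.2⟩, hA.2.1⟩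
  · rintro T hDT hTd ⟨A, hA, hTA⟩
    have hTX : ∀ x ∈ T, x ∉ X := fun x hx hxX =>
      (mem_filter.1 hA).2 ⟨x, mem_inter.2 ⟨hTA hx, hxX⟩⟩
    have hTn : ¬ Hits d F T := by
      intro hT
      have h1 := hT.le_card (by omega) (hF.dwise hn) hF.nontrivial
      have h2 := card_sdiff_of_subset hDT
      have h3 : D ∪ T \ D = T := union_sdiff_of_subset hDT
      by_cases hTc : T.card = d
      · obtain ⟨x, hx⟩ := card_eq_one.1 (by omega : (T \ D).card = 1)
        have hxT : x ∈ T \ D := by rw [hx]; exact mem_singleton_self x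
        rw [mem_sdiff] at hxT
        refine hTX x hxT.1 ((hC.mem_iff x hxT.2).2 ?_)
        rw [insert_eq, union_comm, ← hx, h3]
        exact hT
      · exact hB ⟨T \ D, by omega, disjoint_sdiff,
          disjoint_right.2 fun x hx => hTX x (mem_sdiff.1 hx).1, by rwa [h3]⟩
    obtain ⟨S, hS, hc, ⟨C, hCS⟩, hdis⟩ := exists_common_of_not_hits (by omega) hF.nontrivial hn hTn
    set I := univ.filter fun x => ∀ A ∈ S, x ∈ A with hI
    have hDC : ¬ D ⊆ C := by
      refine hC.exists_notMem_of_common hF hn hS hc (fun x hx => ?_) C hCS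
      by_contra! hcon
      exact disjoint_left.1 hdis (mem_filter.2 ⟨mem_univ _, hcon⟩) (hDT hx)
    refine ⟨I \ X, ?_, hdis.mono_left sdiff_subset, fun A hA _ => ?_⟩
    · have h1 := hC.card_residue hF hn (hS hCS) hDC
      have h2 : I \ X ⊆ C \ (D ∪ X) := by
        intro x hx
        rw [mem_sdiff] at hx
        rw [mem_sdiff, mem_union, not_or]
        exact ⟨(mem_filter.1 hx.1).2 C hCS, fun hxD => disjoint_left.1 hdis hx.1 (hDT hxD), hx.2⟩
      have := card_le_card h2
      omega
    · rw [mem_filter] at hA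
      obtain ⟨x, hx, h⟩ := hits_of_mem (hF.dwise hn) hA.1 S hS hc
      exact ⟨x, mem_inter.2 ⟨hx, mem_sdiff.2 ⟨mem_filter.2 ⟨mem_univ _, h⟩,
        fun hxX => hA.2 ⟨x, mem_inter.2 ⟨hx, hxX⟩⟩⟩⟩⟩

theorem card_filter_meet (hDX : Disjoint D X) (hD : D.card ≤ k) :
    ((kSubsets n k).filter fun A => D ⊆ A ∧ (A ∩ X).Nonempty).card +
      (n - D.card - X.card).choose (k - D.card) = (n - D.card).choose (k - D.card) := by
  rw [← card_filter_subset hD, ← card_filter_subset_disjoint hDX hD,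
    ← card_filter_add_card_filter_not (s := (kSubsets n k).filter fun A => D ⊆ A)
      (fun A => (A ∩ X).Nonempty), filter_filter, filter_filter]
  simp only [not_nonempty_iff_eq_empty, disjoint_iff_inter_eq_empty]

theorem card_filter_miss (hDX : Disjoint D X) (hc : D.card + X.card ≤ k + 1) :
    ((kSubsets n k).filter fun A => (D \ A).card = 1 ∧ X ⊆ A).card =
      D.card * (n - D.card - X.card).choose (k + 1 - D.card - X.card) := by
  have h : ((kSubsets n k).filter fun A => (D \ A).card = 1 ∧ X ⊆ A) =
      D.biUnion fun x => (kSubsets n k).filter fun A => D.erase x ∪ X ⊆ A ∧ Disjoint A {x} := by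
    ext A
    simp only [mem_filter, mem_biUnion, disjoint_singleton_right, union_subset_iff]
    constructor
    · rintro ⟨hA, h1, h2⟩
      obtain ⟨x, hx⟩ := card_eq_one.1 h1
      have hxD : x ∈ D \ A := by rw [hx]; exact mem_singleton_self x
      rw [mem_sdiff] at hxD
      refine ⟨x, hxD.1, hA, ⟨fun y hy => ?_, h2⟩, hxD.2⟩
      rw [mem_erase] at hy
      by_contra hyA
      exact hy.1 (eq_of_card_sdiff_eq_one h1 hy.2 hyA hxD.1 hxD.2)
    · rintro ⟨x, hxD, hA, ⟨h1, h2⟩, hxA⟩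
      exact ⟨hA, by rw [sdiff_eq_singleton_of_erase_subset hxD h1 hxA, card_singleton], h2⟩
  rw [h, card_biUnion]
  · refine sum_const_nat fun x hx => ?_
    have h1 := card_erase_union hDX hx
    rw [card_filter_subset_disjoint _ (by omega), card_singleton]
    · congr 1 <;> omega
    · rw [disjoint_singleton_right, mem_union, not_or]
      exact ⟨notMem_erase _ _, disjoint_left.1 hDX hx⟩
  · intro x hx y hy hne
    refine disjoint_left.2 fun A hA hA' => ?_
    simp only [mem_filter, disjoint_singleton_right, union_subset_iff] at hA hA'
    exact hA.2.2 (hA'.2.1.1 (mem_erase.2 ⟨hne, hx⟩))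

theorem card_starH :
    (starH k D X).card = ((kSubsets n k).filter fun A => D ⊆ A ∧ (A ∩ X).Nonempty).card +
      ((kSubsets n k).filter fun A => (D \ A).card = 1 ∧ X ⊆ A).card := by
  rw [starH, filter_or, card_union_of_disjoint]
  refine disjoint_left.2 fun A hA hA' => ?_
  have h1 := (mem_filter.1 hA').2.1
  rw [sdiff_eq_empty_iff_subset.2 (mem_filter.1 hA).2.1] at h1
  simp at h1

/-- The exact size of G is never needed: this bound and `le_card_starG` suffice to place it among
the other families. -/
theorem card_starG_le :
    (starG k D X B u).card ≤ ((kSubsets n k).filter fun A => D ⊆ A ∧ (A ∩ X).Nonempty).card +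
      ((kSubsets n k).filter fun A => D ∪ B ⊆ A).card +
      ((kSubsets n k).filter fun A => (D \ A).card = 1 ∧ X ⊆ A).card := by
  refine (card_le_card (t := _ ∪ _ ∪ _) fun A hA => ?_).trans
    ((card_union_le _ _).trans (Nat.add_le_add_right (card_union_le _ _) _))
  rw [starG, mem_filter] at hA
  simp only [mem_union, mem_filter, union_subset_iff]
  tauto

theorem le_card_starG :
    ((kSubsets n k).filter fun A => D ⊆ A ∧ (A ∩ X).Nonempty).card +
      ((kSubsets n k).filter fun A => D ∪ B ⊆ A ∧ Disjoint A X).card ≤ (starG k D X B u).card := by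
  rw [← card_union_of_disjoint]
  · refine card_le_card fun A hA => ?_
    simp only [mem_union, mem_filter, union_subset_iff] at hA
    rw [starG, mem_filter]
    tauto
  · refine disjoint_left.2 fun A hA hA' => ?_
    rw [mem_filter] at hA hA'
    rw [disjoint_iff_inter_eq_empty] at hA'
    exact absurd hA'.2.2 hA.2.2.ne_empty

theorem IsCore.card_le (hC : IsCore d F D X) (hF : IsMaxNontrivial k d F) (hn : 0 < n) :
    F.card ≤ ((kSubsets n k).filter fun A => D ⊆ A ∧ (A ∩ X).Nonempty).card +
      (F.filter fun A => D ⊆ A ∧ ¬ (A ∩ X).Nonempty).card +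
      ((kSubsets n k).filter fun A => (D \ A).card = 1 ∧ X ⊆ A).card := by
  refine (card_le_card (t := _ ∪ _ ∪ _) fun A hA => ?_).trans
    ((card_union_le _ _).trans (Nat.add_le_add_right (card_union_le _ _) _))
  have h1 := hF.uniform hA
  have h2 := hC.miss hF hn hA
  simp only [mem_union, mem_filter]
  tauto

end

/-! ### Binomial estimates -/

section

/-- The number of `(r + 1)`-subsets of an `(N + 1)`-set that meet a given `l`-set. -/
def meetCount (N r l : ℕ) : ℕ := ∑ i ∈ range l, (N - i).choose r

theorem meetCount_add_choose {N r l : ℕ} (hl : l ≤ N + 1) :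
    meetCount N r l + (N + 1 - l).choose (r + 1) = (N + 1).choose (r + 1) := by
  induction l with
  | zero => simp [meetCount]
  | succ l ih =>
    rw [meetCount, sum_range_succ, ← meetCount, ← ih (by omega),
      show N + 1 - l = (N - l) + 1 by omega, Nat.choose_succ_succ,
      show N + 1 - (l + 1) = N - l by omega, add_assoc]

theorem meetCount_mono {N r l m : ℕ} (h : l ≤ m) : meetCount N r l ≤ meetCount N r m :=
  sum_le_sum_of_subset (range_subset_range.2 h)

theorem meetCount_succ (N r l : ℕ) :
    meetCount N r (l + 1) = meetCount N r l + (N - l).choose r := sum_range_succ _ _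

theorem meetCount_le (N r l : ℕ) : meetCount N r l ≤ l * N.choose r := by
  have := sum_le_card_nsmul (range l) (fun i => (N - i).choose r) (N.choose r)
    fun i _ => Nat.choose_le_choose r (Nat.sub_le N i)
  simpa [meetCount] using this

theorem choose_le_choose_sub_add {N r i : ℕ} (hr : 1 ≤ r) (hi : i ≤ N) :
    N.choose r ≤ (N - i).choose r + i * (N - 1).choose (r - 1) := by
  induction i with
  | zero => simp
  | succ i ih =>
    have h1 := ih (by omega)
    obtain ⟨s, rfl⟩ : ∃ s, r = s + 1 := ⟨r - 1, by omega⟩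
    have h2 : (N - i).choose (s + 1) = (N - (i + 1)).choose s + (N - (i + 1)).choose (s + 1) := by
      rw [show N - i = (N - (i + 1)) + 1 by omega, Nat.choose_succ_succ]
    have h3 : (N - (i + 1)).choose s ≤ (N - 1).choose s := Nat.choose_le_choose s (by omega)
    simp only [Nat.add_sub_cancel] at h1 ⊢
    rw [add_mul]
    omega

theorem le_meetCount_add {N r l : ℕ} (hr : 1 ≤ r) (hl : l ≤ N) :
    l * N.choose r ≤ meetCount N r l + l * l * (N - 1).choose (r - 1) := by
  have : ∀ i ∈ range l, N.choose r ≤ (N - i).choose r + l * (N - 1).choose (r - 1) := by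
    intro i hi
    rw [mem_range] at hi
    exact (choose_le_choose_sub_add hr (by omega)).trans
      (Nat.add_le_add_left (Nat.mul_le_mul_right _ hi.le) _)
  have := sum_le_sum this
  rw [sum_add_distrib] at this
  simpa [meetCount, mul_assoc] using this

theorem choose_le_choose_of_le_half {M i j : ℕ} (hij : i ≤ j) (hj : 2 * j ≤ M) :
    M.choose i ≤ M.choose j := by
  induction j, hij using Nat.le_induction with
  | base => exact le_rfl
  | succ j _ ih =>
    exact (ih (by omega)).trans (Nat.choose_le_succ_of_lt_half_left (by omega))

/-- The tie-breaker: both main sums have d + 1 terms. By Pascal's rule C(N-1, r) exceeds C(N-i, r)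
by at least C(N-2, r-1) for the d - 1 indices i ≥ 2, and by a further C(N-3, r-1) for the d - 2
indices i ≥ 3. -/
theorem meetCount_second_order {N r d : ℕ} (hr : 1 ≤ r) (hd : 2 ≤ d) (hN : 3 ≤ N) :
    meetCount N r (d + 1) + (d - 1) * (N - 2).choose (r - 1) + (d - 2) * (N - 3).choose (r - 1) ≤
      N.choose r + d * (N - 1).choose r := by
  obtain ⟨e, rfl⟩ : ∃ e, d = e + 2 := ⟨d - 2, by omega⟩
  obtain ⟨M, rfl⟩ : ∃ M, N = M + 3 := ⟨N - 3, by omega⟩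
  obtain ⟨s, rfl⟩ : ∃ s, r = s + 1 := ⟨r - 1, by omega⟩
  have h1 : meetCount (M + 3) (s + 1) (e + 2 + 1) ≤ (M + 3).choose (s + 1) +
      (M + 2).choose (s + 1) + (M + 1).choose (s + 1) + e * M.choose (s + 1) := by
    have h : meetCount (M + 3) (s + 1) (e + 2 + 1) = (∑ i ∈ range e, (M - i).choose (s + 1)) +
        (M + 1).choose (s + 1) + (M + 2).choose (s + 1) + (M + 3).choose (s + 1) := by
      rw [meetCount, sum_range_succ', sum_range_succ', sum_range_succ']
      congr 3
      refine sum_congr rfl fun i _ => ?_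
      congr 1
      omega
    have := meetCount_le M (s + 1) e
    rw [meetCount] at this
    omega
  have h2 : (M + 2).choose (s + 1) = (M + 1).choose s + (M + 1).choose (s + 1) :=
    Nat.choose_succ_succ _ _
  have h3 : (M + 1).choose (s + 1) = M.choose s + M.choose (s + 1) := Nat.choose_succ_succ _ _
  have e1 : M + 3 - 1 = M + 2 := rfl
  have e2 : M + 3 - 2 = M + 1 := rfl
  have e3 : M + 3 - 3 = M := rfl
  simp only [e1, e2, e3, Nat.add_sub_cancel, show e + 2 - 1 = e + 1 from rfl]
  nlinarith

/-- The size of `H`, in terms of `N = n - d` and `r = k - d`. -/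
def sizeH (N r d l : ℕ) : ℕ := meetCount N r l + (d - 1) * (N + 1 - l).choose (r + 2 - l)

theorem sizeH_two {N r d : ℕ} (hd : 1 ≤ d) : sizeH N r d 2 = N.choose r + d * (N - 1).choose r := by
  obtain ⟨e, rfl⟩ : ∃ e, d = e + 1 := ⟨d - 1, by omega⟩
  simp only [sizeH, meetCount, sum_range_succ, range_zero, sum_empty, Nat.add_sub_cancel,
    show N + 1 - 2 = N - 1 by omega, Nat.sub_zero]
  ring

/-! ### Size comparisons for large N, with K = (r + d)^(r + d) absorbing the constants -/

section Asymptotic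

variable {N r d : ℕ}

theorem pow_bounds (hd : 3 ≤ d) (hr : 2 ≤ r) :
    (r + d) ^ (d + 1) ≤ (r + d) ^ (r + d) ∧ 5 * (r + d) ^ 2 ≤ (r + d) ^ (r + d) := by
  refine ⟨Nat.pow_le_pow_right (by omega) (by omega), ?_⟩
  calc 5 * (r + d) ^ 2 ≤ (r + d) * (r + d) ^ 2 := Nat.mul_le_mul_right _ (by omega)
    _ = (r + d) ^ 3 := by ring
    _ ≤ _ := Nat.pow_le_pow_right (by omega) (by omega)

/-- From r · C(N, r) = N · C(N-1, r-1). -/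
theorem choose_first (hr : 2 ≤ r) {K : ℕ} (hN : 240 * r * K ≤ N) (hN0 : 1 ≤ N) :
    240 * K * (N - 1).choose (r - 1) ≤ N.choose r := by
  obtain ⟨M, rfl⟩ : ∃ M, N = M + 1 := ⟨N - 1, by omega⟩
  obtain ⟨s, rfl⟩ : ∃ s, r = s + 1 := ⟨r - 1, by omega⟩
  have h := Nat.add_one_mul_choose_eq M s
  simp only [Nat.add_sub_cancel] at h ⊢
  have h2 := Nat.mul_le_mul_right (M.choose s) hN
  rw [h] at h2
  refine Nat.le_of_mul_le_mul_right (c := s + 1) ?_ (by omega)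
  calc _ = 240 * (s + 1) * K * M.choose s := by ring
    _ ≤ _ := h2

theorem choose_second (hr : 2 ≤ r) {K : ℕ} (hK : 1 ≤ K) (hN : 240 * r * K ≤ N) :
    200 * K * (N - 2).choose (r - 2) ≤ (N - 1).choose (r - 1) := by
  have hrK : r ≤ r * K := Nat.le_mul_of_pos_right r hK
  obtain ⟨M, rfl⟩ : ∃ M, N = M + 2 := ⟨N - 2, by rw [mul_assoc] at hN; omega⟩
  obtain ⟨s, rfl⟩ : ∃ s, r = s + 2 := ⟨r - 2, by omega⟩
  have h := Nat.add_one_mul_choose_eq M s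
  simp only [Nat.add_sub_cancel, show M + 2 - 1 = M + 1 from rfl,
    show s + 2 - 1 = s + 1 from rfl] at h ⊢
  have h2 := Nat.mul_le_mul_right (M.choose s) (show 200 * K * (s + 1) ≤ M + 1 by nlinarith)
  rw [h] at h2
  refine Nat.le_of_mul_le_mul_right (c := s + 1) ?_ (by omega)
  calc _ = 200 * K * (s + 1) * M.choose s := by ring
    _ ≤ _ := h2

theorem large_bounds (hd : 3 ≤ d) (hr : 2 ≤ r) (hN : 240 * r * (r + d) ^ (r + d) ≤ N) :
    480 * (r + d) ^ (r + d) ≤ N ∧ 100 * (r + d) ≤ N := by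
  have h1 := (pow_bounds hd hr).2
  have h2 : 240 * 2 * (r + d) ^ (r + d) ≤ 240 * r * (r + d) ^ (r + d) :=
    Nat.mul_le_mul_right _ (by omega)
  constructor <;> nlinarith

/-- One more unit in the leading coefficient outweighs the error: the terms k^(d+1) and (g+1)² are
each at most K, while C(N, r) is at least 240 K · C(N-1, r-1). The left side is the bound for a
family with g generators. -/
theorem general_lt_meetCount (hd : 3 ≤ d) (hr : 2 ≤ r) (hN : 240 * r * (r + d) ^ (r + d) ≤ N)
    {g : ℕ} (hg : g ≤ r) :
    g * N.choose r + (r + d) ^ (d + 1) * (N - 1).choose (r - 1) < meetCount N r (g + 1) := by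
  obtain ⟨hK1, hK2⟩ := pow_bounds hd hr
  obtain ⟨hN1, hN2⟩ := large_bounds hd hr hN
  have h1 := choose_first hr hN (by omega)
  have h2 := le_meetCount_add (N := N) (r := r) (l := g + 1) (by omega) (by omega)
  have h3 : 0 < (N - 1).choose (r - 1) := Nat.choose_pos (by omega)
  set c1 := (N - 1).choose (r - 1)
  set K := (r + d) ^ (r + d)
  have h4 : (g + 1) * (g + 1) ≤ K := by nlinarith
  have h5 := Nat.mul_le_mul_right c1 h4
  have h6 := Nat.mul_le_mul_right c1 hK1
  have h7 : 0 < K * c1 := Nat.mul_pos (by positivity) h3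
  nlinarith

theorem sizeH_succ_lt (hd : 3 ≤ d) (hr : 2 ≤ r) (hN : 240 * r * (r + d) ^ (r + d) ≤ N) :
    sizeH N r d (r + 1) < sizeH N r d (r + 2) := by
  obtain ⟨hK1, hK2⟩ := pow_bounds hd hr
  obtain ⟨hN1, hN2⟩ := large_bounds hd hr hN
  have h1 := choose_first hr hN (by omega)
  have h2 := choose_le_choose_sub_add (N := N) (r := r) (i := r + 1) (by omega) (by omega)
  have h3 : (N - 1).choose 1 ≤ (N - 1).choose (r - 1) :=
    choose_le_choose_of_le_half (by omega) (by omega)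
  have h4 : (N + 1 - (r + 1)).choose (r + 2 - (r + 1)) = N - r := by
    rw [show r + 2 - (r + 1) = 1 by omega, Nat.choose_one_right]; omega
  rw [sizeH, sizeH, meetCount_succ N r (r + 1), h4, Nat.sub_self, Nat.choose_zero_right]
  rw [Nat.choose_one_right] at h3
  set c1 := (N - 1).choose (r - 1)
  set K := (r + d) ^ (r + d)
  have h5 : (d - 1) * (N - r) ≤ d * c1 := Nat.mul_le_mul (by omega) (by omega)
  have h6 : d + r + 1 ≤ K := by nlinarith
  have h7 := Nat.mul_le_mul_right c1 h6
  have h8 : 0 < K * c1 := Nat.mul_pos (by positivity) (by omega)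
  nlinarith

theorem sizeH_lt_sizeH_two (hd : 3 ≤ d) (hr : 2 ≤ r) (hN : 240 * r * (r + d) ^ (r + d) ≤ N)
    {l : ℕ} (hl : r + 1 ≤ l) (hl' : l ≤ r + 2) (hld : l ≤ d + 1) :
    sizeH N r d l < sizeH N r d 2 := by
  obtain ⟨hN1, hN2⟩ := large_bounds hd hr hN
  rw [sizeH_two (by omega)]
  have h1 := meetCount_second_order (N := N) (r := r) (d := d) (by omega) (by omega) (by omega)
  have h2 : (N - 2).choose 1 ≤ (N - 2).choose (r - 1) :=
    choose_le_choose_of_le_half (by omega) (by omega)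
  have h3 : 0 < (N - 3).choose (r - 1) := Nat.choose_pos (by omega)
  have h4 : (N + 1 - l).choose (r + 2 - l) ≤ N - r := by
    obtain rfl | rfl : l = r + 1 ∨ l = r + 2 := by omega
    · rw [show r + 2 - (r + 1) = 1 by omega, Nat.choose_one_right]; omega
    · rw [Nat.sub_self, Nat.choose_zero_right]; omega
  have h5 := meetCount_mono (N := N) (r := r) hld
  rw [Nat.choose_one_right] at h2
  have h6 : (d - 1) * (N + 1 - l).choose (r + 2 - l) ≤ (d - 1) * (N - 2).choose (r - 1) :=
    Nat.mul_le_mul_left _ (by omega)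
  -- For r = 2 and l = 3 the term `h6` is an equality, so strictness rests on this one, which needs
  -- d ≥ 3.
  have h7 : 0 < (d - 2) * (N - 3).choose (r - 1) := Nat.mul_pos (by omega) h3
  rw [sizeH]
  omega

theorem sizeH_two_lt_meetCount (hd : 3 ≤ d) (hr : 2 ≤ r) (hN : 240 * r * (r + d) ^ (r + d) ≤ N) :
    sizeH N r d 2 < meetCount N r (d + 2) := by
  obtain ⟨hK1, hK2⟩ := pow_bounds hd hr
  obtain ⟨hN1, hN2⟩ := large_bounds hd hr hN
  rw [sizeH_two (by omega)]
  have h1 := choose_first hr hN (by omega)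
  have h2 := le_meetCount_add (N := N) (r := r) (l := d + 2) (by omega) (by omega)
  have h3 : 0 < (N - 1).choose (r - 1) := Nat.choose_pos (by omega)
  have h4 : (N - 1).choose r ≤ N.choose r := Nat.choose_le_choose r (by omega)
  have h4' := Nat.mul_le_mul_left d h4
  set c1 := (N - 1).choose (r - 1)
  set K := (r + d) ^ (r + d)
  have h5 : (d + 2) * (d + 2) ≤ K := by nlinarith
  have h6 := Nat.mul_le_mul_right c1 h5
  have h7 : 0 < K * c1 := Nat.mul_pos (by positivity) h3
  nlinarith

theorem general_lt_sizeH_two (hd : 3 ≤ d) (hr : 2 ≤ r) (hN : 240 * r * (r + d) ^ (r + d) ≤ N)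
    {g : ℕ} (hg : g ≤ d) :
    g * N.choose r + (r + d) ^ (d + 1) * (N - 1).choose (r - 1) < sizeH N r d 2 := by
  obtain ⟨hK1, hK2⟩ := pow_bounds hd hr
  obtain ⟨hN1, hN2⟩ := large_bounds hd hr hN
  rw [sizeH_two (by omega)]
  have h1 := choose_first hr hN (by omega)
  have h2 := choose_le_choose_sub_add (N := N) (r := r) (i := 1) (by omega) (by omega)
  have h3 : 0 < (N - 1).choose (r - 1) := Nat.choose_pos (by omega)
  set c1 := (N - 1).choose (r - 1)
  set K := (r + d) ^ (r + d)
  have h2' := Nat.mul_le_mul_left d h2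
  have h4 := Nat.mul_le_mul_right (N.choose r) hg
  have h5 := Nat.mul_le_mul_right c1 hK1
  have h6 : d ≤ K := by nlinarith
  have h7 := Nat.mul_le_mul_right c1 h6
  have h8 : 0 < K * c1 := Nat.mul_pos (by positivity) h3
  nlinarith

theorem choose_two_le (hd : 3 ≤ d) (hr : 2 ≤ r) (hN : 240 * r * (r + d) ^ (r + d) ≤ N)
    (hr4 : 4 ≤ r) : (N + 1 - r).choose 2 ≤ (N - 2).choose (r - 2) := by
  obtain ⟨hN1, hN2⟩ := large_bounds hd hr hN
  exact (Nat.choose_le_choose 2 (by omega)).trans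
    (choose_le_choose_of_le_half (by omega) (by omega))

/-- For the case r = d + 1. The two options for w bound the members that contain D and avoid X, for
G and for other cores with |X| = r. The advantage of H(k,d,2) is at least d - 1 ≥ 2 copies of C(N-2,
r-1), which beats even w = C(N-1, r-1). -/
theorem second_order_lt_sizeH_two (hd : 3 ≤ d) (hr : 2 ≤ r) (hN : 240 * r * (r + d) ^ (r + d) ≤ N)
    (hr4 : 4 ≤ r) {w : ℕ}
    (hw : w ≤ (N - 1).choose (r - 1) ∨ w ≤ 8 * (N - 2).choose (r - 2)) :
    meetCount N r (d + 1) + w + (d - 1) * (N + 1 - r).choose 2 < sizeH N r d 2 := by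
  obtain ⟨hK1, hK2⟩ := pow_bounds hd hr
  obtain ⟨hN1, hN2⟩ := large_bounds hd hr hN
  rw [sizeH_two (by omega)]
  have h1 := meetCount_second_order (N := N) (r := r) (d := d) (by omega) (by omega) (by omega)
  have h2 := choose_two_le hd hr hN hr4
  have h3 := choose_second hr (Nat.one_le_pow _ _ (by omega)) hN
  have h4 : 0 < (N - 2).choose (r - 2) := Nat.choose_pos (by omega)
  have h5 : (N - 1).choose (r - 1) = (N - 2).choose (r - 2) + (N - 2).choose (r - 1) := by
    rw [show N - 1 = (N - 2) + 1 by omega, show r - 1 = (r - 2) + 1 by omega,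
      Nat.choose_succ_succ]
  have h6 : 1 ≤ (r + d) ^ (r + d) := Nat.one_le_pow _ _ (by omega)
  have h7 := Nat.mul_le_mul_right (200 * (N - 2).choose (r - 2)) h6
  set c1 := (N - 1).choose (r - 1)
  set c2 := (N - 2).choose (r - 2)
  set c1' := (N - 2).choose (r - 1)
  set Q := (N + 1 - r).choose 2
  set K := (r + d) ^ (r + d)
  have h8 : 200 * c2 ≤ c1 := by nlinarith
  obtain ⟨e, rfl⟩ : ∃ e, d = e + 3 := ⟨d - 3, by omega⟩
  have h9 : w < 2 * (c1' - c2) := by omega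
  have h10 : (e + 2) * (c1' - c2) + (e + 2) * c2 = (e + 2) * c1' := by
    rw [← mul_add, Nat.sub_add_cancel (by omega)]
  have h11 : (e + 2) * Q ≤ (e + 2) * c2 := Nat.mul_le_mul_left _ h2
  have h12 : 2 * (c1' - c2) ≤ (e + 2) * (c1' - c2) := Nat.mul_le_mul_right _ (by omega)
  simp only [show e + 3 - 1 = e + 2 from rfl] at h1 ⊢
  omega

theorem sizeG_lt_meetCount (hd : 3 ≤ d) (hr : 2 ≤ r) (hN : 240 * r * (r + d) ^ (r + d) ≤ N)
    (hr4 : 4 ≤ r) :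
    meetCount N r r + (N - 1).choose (r - 1) + (d - 1) * (N + 1 - r).choose 2 <
      meetCount N r (r + 1) := by
  obtain ⟨hK1, hK2⟩ := pow_bounds hd hr
  obtain ⟨hN1, hN2⟩ := large_bounds hd hr hN
  have h0 := choose_first hr hN (by omega)
  have h2 := choose_two_le hd hr hN hr4
  have h3 := choose_second hr (Nat.one_le_pow _ _ (by omega)) hN
  have h4 := choose_le_choose_sub_add (N := N) (r := r) (i := r) (by omega) (by omega)
  have h5 : 0 < (N - 1).choose (r - 1) := Nat.choose_pos (by omega)
  have h6 : 1 ≤ (r + d) ^ (r + d) := Nat.one_le_pow _ _ (by omega)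
  rw [meetCount_succ]
  set c1 := (N - 1).choose (r - 1)
  set c2 := (N - 2).choose (r - 2)
  set Q := (N + 1 - r).choose 2
  set K := (r + d) ^ (r + d)
  have h7 : Q ≤ c1 := by nlinarith
  have h8 : (d - 1) * Q ≤ d * c1 := Nat.mul_le_mul (by omega) h7
  have h9 : d + r + 1 ≤ K := by nlinarith
  have h10 := Nat.mul_le_mul_right c1 h9
  nlinarith

/-- Separates G from the other families with |X| = r: the sets containing D ∪ B and avoiding X
contribute order C(N-1, r-1), while the competitors gain only order C(N-2, r-2). -/
theorem lt_sizeG (hd : 3 ≤ d) (hr : 2 ≤ r) (hN : 240 * r * (r + d) ^ (r + d) ≤ N)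
    (hr4 : 4 ≤ r) :
    meetCount N r r + 8 * (N - 2).choose (r - 2) + (d - 1) * (N + 1 - r).choose 2 <
      meetCount N r r + (N - 1 - r).choose (r - 1) := by
  obtain ⟨hK1, hK2⟩ := pow_bounds hd hr
  obtain ⟨hN1, hN2⟩ := large_bounds hd hr hN
  have h2 := choose_two_le hd hr hN hr4
  have h3 := choose_second hr (Nat.one_le_pow _ _ (by omega)) hN
  have h4 := choose_le_choose_sub_add (N := N - 1) (r := r - 1) (i := r) (by omega) (by omega)
  rw [Nat.sub_sub N 1 1, Nat.sub_sub r] at h4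
  have h5 : 0 < (N - 2).choose (r - 2) := Nat.choose_pos (by omega)
  set c1 := (N - 1).choose (r - 1)
  set c2 := (N - 2).choose (r - 2)
  set Q := (N + 1 - r).choose 2
  set K := (r + d) ^ (r + d)
  have h8 : (d - 1) * Q ≤ d * c2 := Nat.mul_le_mul (by omega) h2
  have h9 : d + r + 8 ≤ K := by nlinarith
  have h10 := Nat.mul_le_mul_right c2 h9
  have h11 : 0 < K * c2 := Nat.mul_pos (by positivity) h5
  nlinarith

end Asymptotic

/-- With k = r + d one has k^r - 1 ≥ k, r² ≥ r and k! ≥ 5! = 120; the factor 240 is 2 · 120. -/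
theorem le_of_threshold_lt {n r d : ℕ} (hd : 3 ≤ d) (hr : 2 ≤ r) (hn : n₁ (r + d) d < n + d) :
    240 * r * (r + d) ^ (r + d) ≤ n := by
  have h1 : r + d ≤ (r + d) ^ r - 1 := by
    have : (r + d) ^ 2 ≤ (r + d) ^ r := Nat.pow_le_pow_right (by omega) hr
    have : r + d + 1 ≤ (r + d) ^ 2 := by nlinarith
    omega
  have h2 : (r + d) ^ (r + d) ≤ ((r + d) ^ r - 1) ^ (r + d) := Nat.pow_le_pow_left h1 _
  have h3 : 120 ≤ (r + d).factorial := (Nat.factorial_le (m := 5) (by omega))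
  have h4 : r ≤ r ^ 2 := by nlinarith
  rw [n₁, Nat.add_sub_cancel] at hn
  have h5 : 2 * r * (r + d) ^ (r + d) * 120 ≤
      2 * r ^ 2 * ((r + d) ^ r - 1) ^ (r + d) * (r + d).factorial :=
    Nat.mul_le_mul (Nat.mul_le_mul (Nat.mul_le_mul_left 2 h4) h2) h3
  have h6 : 240 * r * (r + d) ^ (r + d) = 2 * r * (r + d) ^ (r + d) * 120 := by ring
  omega

end

/-! ### Isomorphism with the explicit families -/

section

section Iso

variable {n k d l : ℕ} {F F' : Finset (Finset (Fin n))} {D X A B : Finset (Fin n)} {u : Fin n}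

theorem image_mem_starH_iff (π : Equiv.Perm (Fin n)) :
    A.image π ∈ starH k (D.image π) (X.image π) ↔ A ∈ starH k D X := by
  rw [mem_starH, mem_starH, card_image_of_injective _ π.injective,
    image_subset_image_iff π.injective, image_subset_image_iff π.injective,
    ← image_inter _ _ π.injective, image_nonempty, ← image_sdiff _ _ π.injective,
    card_image_of_injective _ π.injective]

theorem image_mem_starG_iff (π : Equiv.Perm (Fin n)) :
    A.image π ∈ starG k (D.image π) (X.image π) (B.image π) (π u) ↔ A ∈ starG k D X B u := by
  rw [mem_starG, mem_starG, card_image_of_injective _ π.injective,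
    image_subset_image_iff π.injective, image_subset_image_iff π.injective,
    image_subset_image_iff π.injective,
    ← image_inter _ _ π.injective, image_nonempty, ← image_inter _ _ π.injective, image_nonempty,
    ← image_sdiff _ _ π.injective, card_image_of_injective _ π.injective,
    π.injective.mem_finset_image]

theorem image_symm_image (π : Equiv.Perm (Fin n)) (A : Finset (Fin n)) :
    (A.image π.symm).image π = A := by
  rw [image_image]; simp

theorem image_eq_of_mem_iff (π : Equiv.Perm (Fin n))
    (h : ∀ A : Finset (Fin n), A.image π ∈ F' ↔ A ∈ F) : F.image (fun A => A.image π) = F' := by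
  ext C
  rw [mem_image]
  constructor
  · rintro ⟨A, hA, rfl⟩
    exact (h A).2 hA
  · intro hC
    exact ⟨C.image π.symm, (h _).1 (by rwa [image_symm_image]), image_symm_image π C⟩

theorem Iso.symm (h : Iso F F') : Iso F' F := by
  obtain ⟨π, rfl⟩ := h
  refine ⟨π.symm, ?_⟩
  rw [image_image]
  refine (image_congr fun A _ => ?_).trans image_id
  simpa using image_symm_image π.symm A

theorem Iso.card_eq (h : Iso F F') : F.card = F'.card := by
  obtain ⟨π, rfl⟩ := h
  exact (card_image_of_injective _ (image_injective π.injective)).symm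

/-- A permutation can be changed outside `P` so as to map a set disjoint from `P` onto a given set
of the same size. -/
theorem exists_perm_extend (π : Equiv.Perm (Fin n)) {P A A' : Finset (Fin n)} (hPA : Disjoint P A)
    (hPA' : Disjoint (P.image π) A') (hc : A.card = A'.card) :
    ∃ σ : Equiv.Perm (Fin n), (∀ x ∈ P, σ x = π x) ∧ A.image σ = A' := by
  classical
  let e : A ≃ A' := equivOfCardEq hc
  let f : Fin n → Fin n := fun x =>
    if x ∈ P then π x else if h : x ∈ A then (e ⟨x, h⟩ : Fin n) else x
  have hfP : ∀ x ∈ P, f x = π x := fun x hx => by simp [f, hx]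
  have hfA : ∀ x (hx : x ∈ A), f x = e ⟨x, hx⟩ := fun x hx => by
    simp [f, hx, disjoint_right.1 hPA hx]
  have hinj : Set.InjOn f ((P ∪ A : Finset (Fin n)) : Set (Fin n)) := by
    intro x hx y hy hxy
    rw [mem_coe, mem_union] at hx hy
    rcases hx with hx | hx <;> rcases hy with hy | hy
    · rw [hfP x hx, hfP y hy] at hxy
      exact π.injective hxy
    · rw [hfP x hx, hfA y hy] at hxy
      exact absurd (hxy ▸ (e ⟨y, hy⟩).2) (disjoint_left.1 hPA' (mem_image_of_mem _ hx))
    · rw [hfA x hx, hfP y hy] at hxy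
      exact absurd (hxy ▸ (e ⟨x, hx⟩).2) (disjoint_left.1 hPA' (mem_image_of_mem _ hy))
    · rw [hfA x hx, hfA y hy] at hxy
      have := e.injective (Subtype.ext hxy)
      simpa using this
  obtain ⟨g, hg⟩ := exists_equiv_extend_of_card_eq (α := Fin n) (t := (univ : Finset (Fin n)))
    (by simp) (s := P ∪ A) (f := f) (subset_univ _) hinj
  have hg' : ∀ x ∈ P ∪ A, (g.trans (Equiv.subtypeUnivEquiv mem_univ)) x = f x := hg
  refine ⟨g.trans (Equiv.subtypeUnivEquiv mem_univ), fun x hx => ?_, ?_⟩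
  · rw [hg' x (mem_union_left _ hx), hfP x hx]
  · refine eq_of_subset_of_card_le (image_subset_iff.2 fun x hx => ?_) ?_
    · rw [hg' x (mem_union_right _ hx), hfA x hx]
      exact (e ⟨x, hx⟩).2
    · rw [card_image_of_injective _ (Equiv.injective _), hc]

theorem exists_perm_pair {D' X' : Finset (Fin n)} (h : Disjoint D X) (h' : Disjoint D' X')
    (hD : D.card = D'.card) (hX : X.card = X'.card) :
    ∃ π : Equiv.Perm (Fin n), D.image π = D' ∧ X.image π = X' := by
  obtain ⟨σ, -, h1⟩ := exists_perm_extend (1 : Equiv.Perm (Fin n)) (P := ∅)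
    (disjoint_empty_left D) (by simp) hD
  obtain ⟨π, h2, h3⟩ := exists_perm_extend σ h (by rwa [h1]) hX
  exact ⟨π, by rw [← h1]; exact image_congr h2, h3⟩

/-- The permutation is built in stages, prescribing it on u, then on D \ {u}, X and B. -/
theorem exists_perm_triple {D' X' B' : Finset (Fin n)} {u' : Fin n} (hDX : Disjoint D X)
    (hDX' : Disjoint D' X') (hDB : Disjoint D B) (hDB' : Disjoint D' B') (hXB : Disjoint X B)
    (hXB' : Disjoint X' B') (hu : u ∈ D) (hu' : u' ∈ D') (hD : D.card = D'.card)
    (hX : X.card = X'.card) (hB : B.card = B'.card) :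
    ∃ π : Equiv.Perm (Fin n), D.image π = D' ∧ X.image π = X' ∧ B.image π = B' ∧ π u = u' := by
  obtain ⟨σ, h1, h2⟩ := exists_perm_pair (D := {u}) (D' := {u'}) (X := D.erase u)
    (X' := D'.erase u') (by simp) (by simp) (by simp)
    (by rw [card_erase_of_mem hu, card_erase_of_mem hu', hD])
  have hσu : σ u = u' := by simpa using h1
  have hσD : D.image σ = D' := by
    rw [← insert_erase hu, image_insert, h2, hσu, insert_erase hu']
  obtain ⟨τ, h3, h4⟩ := exists_perm_extend σ hDX (by rwa [hσD]) hX
  have hτD : D.image τ = D' := by rw [← hσD]; exact image_congr h3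
  obtain ⟨π, h5, h6⟩ := exists_perm_extend τ (P := D ∪ X) (disjoint_union_left.2 ⟨hDB, hXB⟩)
    (by rw [image_union, hτD, h4]; exact disjoint_union_left.2 ⟨hDB', hXB'⟩) hB
  refine ⟨π, ?_, ?_, h6, ?_⟩
  · rw [← hτD]; exact image_congr fun x hx => h5 x (mem_union_left _ hx)
  · rw [← h4]; exact image_congr fun x hx => h5 x (mem_union_right _ hx)
  · rw [h5 u (mem_union_left _ hu), h3 u hu, hσu]

theorem mem_seg {a b : ℕ} {x : Fin n} : x ∈ seg n a b ↔ a ≤ x.val + 1 ∧ x.val + 1 ≤ b := by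
  simp [seg]

theorem card_seg {a b : ℕ} (ha : 1 ≤ a) (hb : b ≤ n) : (seg n a b).card = b + 1 - a := by
  have h : (seg n a b).map Fin.valEmbedding = Ico (a - 1) b := by
    ext x
    simp only [mem_map, mem_seg, Fin.valEmbedding_apply, mem_Ico]
    constructor
    · rintro ⟨y, hy, rfl⟩; omega
    · intro hx; exact ⟨⟨x, by omega⟩, by simp; omega, rfl⟩
  rw [← card_map, h, Nat.card_Ico]
  omega

theorem disjoint_seg {a b a' b' : ℕ} (h : b < a') : Disjoint (seg n a b) (seg n a' b') :=
  disjoint_left.2 fun x hx hx' => by rw [mem_seg] at hx hx'; omega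

theorem card_sdiff_eq_one_iff (hD : D.card + 1 = d) (hd : 2 ≤ d) :
    (D ∩ A).card = d - 2 ↔ (D \ A).card = 1 := by
  have := card_sdiff_add_card_inter D A
  omega

theorem familyH_eq (hd : 2 ≤ d) (hn : d - 1 ≤ n) :
    familyH n k d l = starH k (seg n 1 (d - 1)) (seg n d (d + l - 1)) := by
  have hD : (seg n 1 (d - 1)).card + 1 = d := by rw [card_seg le_rfl hn]; omega
  rw [familyH, starH, ← filter_or]
  simp only [card_sdiff_eq_one_iff hD hd]

/-- The isomorphic copies of `H(k, d, l)`. -/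
def IsH (k d l : ℕ) (F : Finset (Finset (Fin n))) : Prop :=
  ∃ D X : Finset (Fin n), D.card + 1 = d ∧ Disjoint D X ∧ X.card = l ∧ F = starH k D X

/-- The isomorphic copies of `G(k, d)`. -/
def IsG (k d : ℕ) (F : Finset (Finset (Fin n))) : Prop :=
  ∃ (D X B : Finset (Fin n)) (u : Fin n), D.card + 1 = d ∧ Disjoint D X ∧ Disjoint D B ∧
    Disjoint X B ∧ d + X.card = k ∧ B.card = 2 ∧ u ∈ D ∧ F = starG k D X B u

theorem isH_familyH (hd : 2 ≤ d) (hn : d + l ≤ n) : IsH k d l (familyH n k d l) :=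
  ⟨_, _, by rw [card_seg le_rfl (by omega)]; omega, disjoint_seg (by omega),
    by rw [card_seg (by omega) (by omega)]; omega, familyH_eq hd (by omega)⟩

theorem iso_familyH_iff (hd : 2 ≤ d) (hn : d + l ≤ n) :
    Iso F (familyH n k d l) ↔ IsH k d l F := by
  obtain ⟨D, X, hD, hDX, hX, h⟩ := isH_familyH (k := k) hd hn
  rw [h]
  constructor
  · intro hi
    obtain ⟨π, rfl⟩ := hi.symm
    refine ⟨D.image π, X.image π, ?_, (disjoint_image π.injective).2 hDX, ?_,
      image_eq_of_mem_iff π fun A => image_mem_starH_iff π⟩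
    · rwa [card_image_of_injective _ π.injective]
    · rwa [card_image_of_injective _ π.injective]
  · rintro ⟨D', X', hD', hDX', hX', rfl⟩
    obtain ⟨π, rfl, rfl⟩ := exists_perm_pair hDX' hDX (by omega) (by omega)
    exact ⟨π, image_eq_of_mem_iff π fun A => image_mem_starH_iff π⟩

theorem exists_union_singleton_eq {C : Finset (Fin n)} (hCA : C ⊆ A) (hc : C.card + 1 = A.card) :
    ∃ i ∈ A, i ∉ C ∧ C ∪ {i} = A := by
  have h1 := card_sdiff_of_subset hCA
  obtain ⟨i, hi⟩ := card_eq_one.1 (by omega : (A \ C).card = 1)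
  have hiA : i ∈ A \ C := by rw [hi]; exact mem_singleton_self i
  rw [mem_sdiff] at hiA
  exact ⟨i, hiA.1, hiA.2, by rw [← hi, union_sdiff_of_subset hCA]⟩

theorem card_union_singleton {C : Finset (Fin n)} {i : Fin n} (h : i ∉ C) :
    (C ∪ {i}).card = C.card + 1 := by
  rw [card_union_of_disjoint (disjoint_singleton_right.2 h), card_singleton]

/-- The two explicit lists are the members missing u that contain exactly one point of B. The rest
of D together with X is [2, k-1], of size k - 2, so one point of B leaves a single free point, which
lies in [k+2, n]. -/
theorem familyG_eq (hd : 2 ≤ d) (hdk : d + 1 ≤ k) (hn : k + 1 ≤ n) :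
    familyG n k d = starG k (seg n 1 (d - 1)) (seg n d (k - 1)) (seg n k (k + 1))
      ⟨0, by omega⟩ := by
  have hD : (seg n 1 (d - 1)).card + 1 = d := by rw [card_seg le_rfl (by omega)]; omega
  have hC1 : (seg n 2 k).card + 1 = k := by rw [card_seg (by omega) (by omega)]; omega
  have hC2 : (seg n 2 (k - 1) ∪ seg n (k + 1) (k + 1)).card + 1 = k := by
    rw [card_union_of_disjoint (disjoint_seg (by omega)), card_seg (by omega) (by omega),
      card_seg (by omega) (by omega)]
    omega
  -- Index 0 stands for the integer 1; likewise the witnesses with values k - 1 and k below stand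
  -- for the integers k and k + 1.
  set u : Fin n := ⟨0, by omega⟩ with hu
  have huD : u ∈ seg n 1 (d - 1) := by rw [mem_seg]; simp only [hu]; omega
  have hDX : seg n d (k + 1) = seg n d (k - 1) ∪ seg n k (k + 1) := by
    ext x; simp only [mem_union, mem_seg]; omega
  have hmiss : ∀ A : Finset (Fin n), (∀ x : Fin n, 2 ≤ x.val + 1 → x.val + 1 ≤ k - 1 → x ∈ A) →
      u ∉ A → (seg n 1 (d - 1) \ A).card = 1 ∧ seg n d (k - 1) ⊆ A := by
    intro A hA huA
    refine ⟨?_, fun x hx => ?_⟩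
    · rw [sdiff_eq_singleton_of_erase_subset huD (fun x hx => ?_) huA, card_singleton]
      rw [mem_erase, mem_seg] at hx
      have : x.val ≠ 0 := fun h => hx.1 (Fin.ext h)
      exact hA x (by omega) (by omega)
    · rw [mem_seg] at hx
      exact hA x (by omega) (by omega)
  ext A
  simp only [familyG, mem_union, mem_filter, mem_kSubsets, mem_image, mem_starG,
    card_sdiff_eq_one_iff hD hd, hDX, union_subset_iff]
  constructor
  · rintro ((((h | ⟨i, hi, rfl⟩) | h) | ⟨i, hi, rfl⟩) | h)
    · exact ⟨h.1, Or.inl ⟨h.2.1, Or.inl h.2.2⟩⟩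
    · rw [mem_seg] at hi
      have hui : u ∉ seg n 2 k ∪ {i} := by
        rw [mem_union, mem_seg, mem_singleton, Fin.ext_iff]
        simp only [hu]
        omega
      obtain ⟨h1, h2⟩ := hmiss _ (fun x hx hx' => mem_union_left _
        (mem_seg.2 ⟨hx, by omega⟩)) hui
      refine ⟨by rw [card_union_singleton (by rw [mem_seg]; omega), hC1],
        Or.inr ⟨h1, h2, Or.inr ⟨hui, ⟨k - 1, by omega⟩, ?_⟩⟩⟩
      simp only [mem_inter, mem_union, mem_seg]
      omega
    · exact ⟨h.1, Or.inl ⟨h.2.1, Or.inr h.2.2⟩⟩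
    · rw [mem_seg] at hi
      rw [← union_assoc]
      have hui : u ∉ seg n 2 (k - 1) ∪ seg n (k + 1) (k + 1) ∪ {i} := by
        rw [mem_union, mem_union, mem_seg, mem_seg, mem_singleton, Fin.ext_iff]
        simp only [hu]
        omega
      obtain ⟨h1, h2⟩ := hmiss _ (fun x hx hx' => mem_union_left _ (mem_union_left _
        (mem_seg.2 ⟨hx, by omega⟩))) hui
      refine ⟨by rw [card_union_singleton (by rw [mem_union, mem_seg, mem_seg]; omega), hC2],
        Or.inr ⟨h1, h2, Or.inr ⟨hui, ⟨k, by omega⟩, ?_⟩⟩⟩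
      simp only [mem_inter, mem_union, mem_seg]
      omega
    · exact ⟨h.1, Or.inr ⟨h.2.1, h.2.2.1, Or.inl h.2.2.2⟩⟩
  · rintro ⟨hA, ⟨h1, h2 | h2⟩ | ⟨h1, h2, h3⟩⟩
    · exact Or.inl (Or.inl (Or.inl (Or.inl ⟨hA, h1, h2⟩)))
    · exact Or.inl (Or.inl (Or.inr ⟨hA, h1, h2⟩))
    by_cases hB : seg n k (k + 1) ⊆ A
    · exact Or.inr ⟨hA, h1, h2, hB⟩
    obtain ⟨huA, b, hb⟩ := h3.resolve_left hB
    obtain ⟨c, hc, hcA⟩ := not_subset.1 hB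
    rw [mem_inter, mem_seg] at hb
    rw [mem_seg] at hc
    have hne : b.val ≠ c.val := fun h => hcA (Fin.ext h ▸ hb.1)
    have hlow : ∀ x : Fin n, 2 ≤ x.val + 1 → x.val + 1 ≤ k - 1 → x ∈ A := by
      intro x hx hx'
      by_cases hxd : d ≤ x.val + 1
      · exact h2 (mem_seg.2 ⟨hxd, hx'⟩)
      · by_contra hxA
        have := eq_of_card_sdiff_eq_one h1 (mem_seg.2 ⟨by omega, by omega⟩) hxA huD huA
        rw [this] at hx
        simp [hu] at hx
    have hhigh : ∀ i ∈ A, i.val + 1 ≤ k + 1 → (2 ≤ i.val + 1 ∧ i.val + 1 ≤ k - 1) ∨ i = b := by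
      intro i hi hik
      have e1 : i.val ≠ 0 := fun h => huA (Fin.ext (b := u) h ▸ hi)
      have e2 : i.val ≠ c.val := fun h => hcA (Fin.ext h ▸ hi)
      rw [Fin.ext_iff]
      omega
    obtain hbk | hbk : b.val + 1 = k ∨ b.val + 1 = k + 1 := by omega
    · obtain ⟨i, hiA, hiC, hi⟩ := exists_union_singleton_eq (C := seg n 2 k) (A := A) (by
        intro x hx
        rw [mem_seg] at hx
        by_cases hxk : x.val + 1 = k
        · have : x = b := Fin.ext (by omega)
          exact this ▸ hb.1
        · exact hlow x hx.1 (by omega)) (by omega)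
      refine Or.inl (Or.inl (Or.inl (Or.inr ⟨i, ?_, hi⟩)))
      rw [mem_seg]
      rw [mem_seg] at hiC
      by_contra hcon
      rcases hhigh i hiA (by have := i.isLt; omega) with h | rfl <;> omega
    · obtain ⟨i, hiA, hiC, hi⟩ := exists_union_singleton_eq
        (C := seg n 2 (k - 1) ∪ seg n (k + 1) (k + 1)) (A := A) (by
        intro x hx
        rw [mem_union, mem_seg, mem_seg] at hx
        rcases hx with hx | hx
        · exact hlow x hx.1 hx.2
        · have : x = b := Fin.ext (by omega)
          exact this ▸ hb.1) (by omega)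
      refine Or.inl (Or.inr ⟨i, ?_, by rw [← union_assoc]; exact hi⟩)
      rw [mem_seg]
      rw [mem_union, mem_seg, mem_seg] at hiC
      by_contra hcon
      rcases hhigh i hiA (by have := i.isLt; omega) with h | rfl <;> omega

theorem isG_familyG (hd : 2 ≤ d) (hdk : d + 1 ≤ k) (hn : k + 1 ≤ n) : IsG k d (familyG n k d) :=
  ⟨_, _, _, _, by rw [card_seg le_rfl (by omega)]; omega, disjoint_seg (by omega),
    disjoint_seg (by omega), disjoint_seg (by omega),
    by rw [card_seg (by omega) (by omega)]; omega, by rw [card_seg (by omega) (by omega)]; omega,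
    by rw [mem_seg]; simp; omega, familyG_eq hd hdk hn⟩

theorem iso_familyG_iff (hd : 2 ≤ d) (hdk : d + 1 ≤ k) (hn : k + 1 ≤ n) :
    Iso F (familyG n k d) ↔ IsG k d F := by
  obtain ⟨D, X, B, u, hD, hDX, hDB, hXB, hX, hB, hu, h⟩ := isG_familyG hd hdk hn
  rw [h]
  constructor
  · intro hi
    obtain ⟨π, rfl⟩ := hi.symm
    refine ⟨D.image π, X.image π, B.image π, π u, ?_, (disjoint_image π.injective).2 hDX,
      (disjoint_image π.injective).2 hDB, (disjoint_image π.injective).2 hXB, ?_, ?_,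
      mem_image_of_mem _ hu, image_eq_of_mem_iff π fun A => image_mem_starG_iff π⟩
    · rwa [card_image_of_injective _ π.injective]
    · rwa [card_image_of_injective _ π.injective]
    · rwa [card_image_of_injective _ π.injective]
  · rintro ⟨D', X', B', u', hD', hDX', hDB', hXB', hX', hB', hu', rfl⟩
    obtain ⟨π, rfl, rfl, rfl, rfl⟩ := exists_perm_triple hDX' hDX hDB' hDB hXB' hXB hu' hu
      (by omega) (by omega) (by omega)
    exact ⟨π, image_eq_of_mem_iff π fun A => image_mem_starG_iff π⟩

end Iso

/-- A family in P₁ or P₂ has at most one size above it, and one smaller than s₃ has at least three.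
The order of s₁ and s₂ is left open, because it changes between r < d and r = d. -/
theorem isNthLargest_three_iff {n k d : ℕ} {P₁ P₂ P₃ : Finset (Finset (Fin n)) → Prop}
    {s₁ s₂ s₃ : ℕ} (h1 : ∀ F, P₁ F → IsMaxNontrivial k d F ∧ F.card = s₁)
    (h2 : ∀ F, P₂ F → IsMaxNontrivial k d F ∧ F.card = s₂)
    (h3 : ∀ F, P₃ F → IsMaxNontrivial k d F ∧ F.card = s₃)
    (e1 : ∃ F, P₁ F) (e2 : ∃ F, P₂ F) (e3 : ∃ F, P₃ F) (h12 : s₁ ≠ s₂) (h31 : s₃ < s₁)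
    (h32 : s₃ < s₂)
    (hrest : ∀ F, IsMaxNontrivial k d F → P₁ F ∨ P₂ F ∨ P₃ F ∨ F.card < s₃)
    (F : Finset (Finset (Fin n))) : IsNthLargest 3 k d F ↔ P₃ F := by
  obtain ⟨F₁, e1⟩ := e1
  obtain ⟨F₂, e2⟩ := e2
  obtain ⟨F₃, e3⟩ := e3
  have hsizes : ∀ m (F' : Finset (Finset (Fin n))), IsMaxNontrivial k d F' ∧ F'.card = m → m = s₁ ∨ m = s₂ ∨ m ≤ s₃ := by
    rintro m F' ⟨hF', rfl⟩
    rcases hrest F' hF' with h | h | h | h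
    · exact Or.inl (h1 _ h).2
    · exact Or.inr (Or.inl (h2 _ h).2)
    · exact Or.inr (Or.inr (h3 _ h).2.le)
    · exact Or.inr (Or.inr h.le)
  constructor
  · rintro ⟨hF, hcard⟩
    set S := {m : ℕ | F.card < m ∧ ∃ F' : Finset (Finset (Fin n)), IsMaxNontrivial k d F' ∧
      F'.card = m} with hS
    have hle : ∀ a, S ⊆ {a} → False := by
      intro a ha
      have := Set.ncard_le_ncard ha (Set.finite_singleton a)
      rw [Set.ncard_singleton] at this
      omega
    rcases hrest F hF with h | h | h | h
    · refine (hle s₂ ?_).elim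
      rintro m ⟨hm, F', hF'⟩
      rw [(h1 F h).2] at hm
      rcases hsizes m F' hF' with h | h | h
      · omega
      · exact h
      · omega
    · refine (hle s₁ ?_).elim
      rintro m ⟨hm, F', hF'⟩
      rw [(h2 F h).2] at hm
      rcases hsizes m F' hF' with h | h | h
      · exact h
      · omega
      · omega
    · exact h
    -- Finiteness matters: `Set.ncard` of an infinite set is 0, and the lower bound 3 would be lost.
    · have hfin : S.Finite := Set.Finite.subset (Set.finite_Iic (max s₁ (max s₂ s₃))) (by
        rintro m ⟨-, F', hF'⟩
        rw [Set.mem_Iic]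
        rcases hsizes m F' hF' with h | h | h <;> omega)
      have hsub : (({s₁, s₂, s₃} : Finset ℕ) : Set ℕ) ⊆ S := by
        intro m hm
        simp only [coe_insert, coe_singleton, Set.mem_insert_iff, Set.mem_singleton_iff] at hm
        rcases hm with rfl | rfl | rfl
        · exact ⟨by omega, F₁, h1 _ e1⟩
        · exact ⟨by omega, F₂, h2 _ e2⟩
        · exact ⟨h, F₃, h3 _ e3⟩
      have := Set.ncard_le_ncard hsub hfin
      rw [Set.ncard_coe_finset, card_eq_three.2 ⟨s₁, s₂, s₃, h12, by omega, by omega, rfl⟩] at this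
      omega
  · intro h
    refine ⟨(h3 F h).1, ?_⟩
    have : {m : ℕ | F.card < m ∧ ∃ F' : Finset (Finset (Fin n)), IsMaxNontrivial k d F' ∧
        F'.card = m} = {s₁, s₂} := by
      ext m
      simp only [Set.mem_ofPred_eq, Set.mem_insert_iff, Set.mem_singleton_iff, (h3 F h).2]
      constructor
      · rintro ⟨hm, F', hF'⟩
        rcases hsizes m F' hF' with h | h | h
        · exact Or.inl h
        · exact Or.inr h
        · omega
      · rintro (rfl | rfl)
        · exact ⟨h31, F₁, h1 _ e1⟩
        · exact ⟨h32, F₂, h2 _ e2⟩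
    rw [this, Set.ncard_pair h12]

end

/-! ### Classification and the three cases, with k = r + d and n = N + d -/

section

variable {N r d : ℕ} {F : Finset (Finset (Fin (N + d)))} {D X B : Finset (Fin (N + d))}

theorem card_filter_meet_eq (hD : D.card + 1 = d) (hDX : Disjoint D X) (hX : X.card ≤ N) :
    ((kSubsets (N + d) (r + d)).filter fun A => D ⊆ A ∧ (A ∩ X).Nonempty).card =
      meetCount N r X.card := by
  have h1 := card_filter_meet (n := N + d) (k := r + d) hDX (by omega)
  have h2 := meetCount_add_choose (N := N) (r := r) (l := X.card) (by omega)
  rw [show N + d - D.card = N + 1 by omega, show r + d - D.card = r + 1 by omega] at h1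
  omega

theorem card_filter_miss_eq (hD : D.card + 1 = d) (hDX : Disjoint D X) (hX : X.card ≤ r + 2) :
    ((kSubsets (N + d) (r + d)).filter fun A => (D \ A).card = 1 ∧ X ⊆ A).card =
      (d - 1) * (N + 1 - X.card).choose (r + 2 - X.card) := by
  rw [card_filter_miss hDX (by omega), show N + d - D.card = N + 1 by omega,
    show r + d + 1 - D.card = r + 2 by omega, show D.card = d - 1 by omega]

theorem card_starH_eq (hD : D.card + 1 = d) (hDX : Disjoint D X) (hX : X.card ≤ N)
    (hX' : X.card ≤ r + 2) : (starH (r + d) D X).card = sizeH N r d X.card := by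
  rw [card_starH, card_filter_meet_eq hD hDX hX, card_filter_miss_eq hD hDX hX', sizeH]

theorem IsH.spec {l : ℕ} (hF : IsH (r + d) d l F) (hd : 3 ≤ d) (hl : 2 ≤ l) (hl' : l ≤ r + 2)
    (hN : 2 * (r + d) ≤ N) : IsMaxNontrivial (r + d) d F ∧ F.card = sizeH N r d l := by
  obtain ⟨D, X, hD, hDX, rfl, rfl⟩ := hF
  exact ⟨starH_isMaxNontrivial hd hD hDX hl (by omega) (by omega),
    card_starH_eq hD hDX (by omega) hl'⟩

theorem IsG.isMaxNontrivial (hF : IsG (r + d) d F) (hd : 3 ≤ d) (hr : 2 ≤ r)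
    (hN : 2 * (r + d) ≤ N) : IsMaxNontrivial (r + d) d F := by
  obtain ⟨D, X, B, u, hD, hDX, hDB, hXB, hX, hB, hu, rfl⟩ := hF
  exact starG_isMaxNontrivial hd hD hDX hDB hXB (by omega) hB hu hX (by omega)

theorem IsG.card_le (hF : IsG (r + d) d F) (hr : 1 ≤ r) (hN : r ≤ N) : F.card ≤
    meetCount N r r + (N - 1).choose (r - 1) + (d - 1) * (N + 1 - r).choose 2 := by
  obtain ⟨D, X, B, u, hD, hDX, hDB, hXB, hX, hB, hu, rfl⟩ := hF
  have h1 := card_starG_le (k := r + d) (D := D) (X := X) (B := B) (u := u)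
  have hXr : X.card = r := by omega
  have hDBc : (D ∪ B).card = d + 1 := by rw [card_union_of_disjoint hDB]; omega
  rw [card_filter_meet_eq hD hDX (by omega), card_filter_miss_eq hD hDX (by omega), hXr,
    card_filter_subset (by omega), hDBc, show N + d - (d + 1) = N - 1 by omega,
    show r + d - (d + 1) = r - 1 by omega, show r + 2 - r = 2 by omega] at h1
  exact h1

theorem IsG.le_card (hF : IsG (r + d) d F) (hr : 1 ≤ r) (hN : r ≤ N) :
    meetCount N r r + (N - 1 - r).choose (r - 1) ≤ F.card := by
  obtain ⟨D, X, B, u, hD, hDX, hDB, hXB, hX, hB, hu, rfl⟩ := hF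
  have h1 := le_card_starG (k := r + d) (D := D) (X := X) (B := B) (u := u)
  have hXr : X.card = r := by omega
  have hDBc : (D ∪ B).card = d + 1 := by rw [card_union_of_disjoint hDB]; omega
  rw [card_filter_meet_eq hD hDX (by omega), hXr, card_filter_subset_disjoint
      (disjoint_union_left.2 ⟨hDX, hXB.symm⟩) (by omega), hDBc, hXr,
    show N + d - (d + 1) - r = N - 1 - r by omega,
    show r + d - (d + 1) = r - 1 by omega] at h1
  exact h1

theorem IsMaxNontrivial.card_le_gens (hF : IsMaxNontrivial (r + d) d F) (hd : 2 ≤ d)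
    (hr : 1 ≤ r) : F.card ≤ (gens d F).card * N.choose r +
      (r + d) ^ (d + 1) * (N - 1).choose (r - 1) := by
  have h := hF.card_le (by omega) hd (by omega)
  rwa [show N + d - d = N by omega, show N + d - (d + 1) = N - 1 by omega,
    show r + d - d = r by omega, show r + d - (d + 1) = r - 1 by omega] at h

/-- Families with a core of the largest size not forcing `H` are copies of `G` or smaller. -/
theorem IsCore.isG_or_card_le (hC : IsCore d F D X) (hF : IsMaxNontrivial (r + d) d F)
    (hd : 3 ≤ d) (hr : 2 ≤ r) (hX : X.card = r) (hN : r ≤ N) :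
    IsG (r + d) d F ∨ F.card ≤ meetCount N r r + 8 * (N - 2).choose (r - 2) +
      (d - 1) * (N + 1 - r).choose 2 := by
  have hD := hC.card_add_one
  rcases hC.eq_starG_or_card_le hF (by omega) hd (by omega) (by omega) with h | h
  · obtain ⟨B, u, hu, hB, hDB, hXB, h⟩ := h
    exact Or.inl ⟨D, X, B, u, hD, hC.disjoint, hDB, hXB, by omega, hB, hu, h⟩
  · right
    have h1 := hC.card_le hF (by omega)
    rw [card_filter_meet_eq hD hC.disjoint (by omega),
      card_filter_miss_eq hD hC.disjoint (by omega), hX,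
      show r + 2 - r = 2 by omega] at h1
    rw [show N + d - (d + 2) = N - 2 by omega, show r + d - (d + 2) = r - 2 by omega] at h
    omega

/-- Outside the three copies of H there are few generators. With fewer than three no structure is
needed; with three or more, the clique alternative gives H(k,d,2), and a core with |X| > r gives one
of the other two. -/
theorem isH_or_gens_le (hF : IsMaxNontrivial (r + d) d F) (hd : 3 ≤ d)
    (hN : r + d ≤ N) : IsH (r + d) d 2 F ∨ IsH (r + d) d (r + 1) F ∨ IsH (r + d) d (r + 2) F ∨
      ((gens d F).card ≤ max r 2 ∧
        (3 ≤ (gens d F).card → ∃ D X, IsCore d F D X ∧ X.card = (gens d F).card)) := by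
  by_cases hg : 3 ≤ (gens d F).card
  swap
  · exact Or.inr (Or.inr (Or.inr ⟨by omega, fun h => absurd h hg⟩))
  rcases star_or_clique (fun T hT => (mem_gens.1 hT).1)
      (fun T hT T' hT' => le_card_inter_of_hits hF (by omega) (by omega) (by omega) hT hT')
      (by omega : 1 < (gens d F).card) with ⟨D, hD, hgD⟩ | ⟨Y, hY, hgY⟩
  · obtain ⟨X, hC, hX⟩ := exists_isCore hD (card_pos.1 (by omega)) hgD
    by_cases hXr : X.card ≤ r
    · exact Or.inr (Or.inr (Or.inr ⟨by omega, fun _ => ⟨D, X, hC, hX⟩⟩))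
    have hle : X.card ≤ r + 2 := by
      obtain ⟨x, hx⟩ : D.Nonempty := card_pos.1 (by omega)
      obtain ⟨A, hA, hxA⟩ := exists_notMem_of_not_isTrivial hF.nontrivial x
      have := hC.card_residue hF (by omega) hA fun h => hxA (h hx)
      omega
    have h := hC.eq_starH hF (by omega) hd (by omega)
    obtain hc | hc : X.card = r + 1 ∨ X.card = r + 2 := by omega
    · exact Or.inr (Or.inl ⟨D, X, hD, hC.disjoint, hc, h⟩)
    · exact Or.inr (Or.inr (Or.inl ⟨D, X, hD, hC.disjoint, hc, h⟩))
  · exact Or.inl (eq_starH_of_gens_subset hF (by omega) (by omega) hY hg hgY)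

/-- Here r + 1 is the smallest of the leading coefficients d + 1, r + 2, r + 1 of the three H. The
tie with d + 1 at r = d, and that between r + 2 and d + 1 at r = d - 1, both go to H(k,d,2). -/
theorem third_largest_of_le (hd : 3 ≤ d) (hr : 2 ≤ r) (hN : 240 * r * (r + d) ^ (r + d) ≤ N)
    (hrd : r ≤ d) (F : Finset (Finset (Fin (N + d)))) :
    IsNthLargest 3 (r + d) d F ↔ IsH (r + d) d (r + 1) F := by
  have hN2 := (large_bounds hd hr hN).2
  have s21 := sizeH_succ_lt hd hr hN
  have s1 := sizeH_lt_sizeH_two hd hr hN (l := r + 1) (by omega) (by omega) (by omega)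
  refine isNthLargest_three_iff (P₁ := IsH (r + d) d 2) (P₂ := IsH (r + d) d (r + 2))
    (fun F hF => hF.spec hd (by omega) (by omega) (by omega))
    (fun F hF => hF.spec hd (by omega) (by omega) (by omega))
    (fun F hF => hF.spec hd (by omega) (by omega) (by omega))
    ⟨_, isH_familyH (by omega) (by omega)⟩ ⟨_, isH_familyH (by omega) (by omega)⟩
    ⟨_, isH_familyH (by omega) (by omega)⟩ ?_ s1 s21 ?_ F
  · by_cases h : r + 1 ≤ d
    · exact (sizeH_lt_sizeH_two hd hr hN (l := r + 2) (by omega) (by omega) (by omega)).ne'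
    · have h1 := sizeH_two_lt_meetCount hd hr hN
      obtain rfl : r = d := by omega
      refine (h1.trans_le ?_).ne
      exact Nat.le_add_right _ _
  · intro F hF
    rcases isH_or_gens_le hF hd (by omega) with h | h | h | ⟨h, -⟩
    · exact Or.inl h
    · exact Or.inr (Or.inr (Or.inl h))
    · exact Or.inr (Or.inl h)
    · refine Or.inr (Or.inr (Or.inr ?_))
      have h1 := hF.card_le_gens (by omega) (by omega)
      have h2 := general_lt_meetCount hd hr hN (g := (gens d F).card) (by omega)
      have h3 := meetCount_mono (N := N) (r := r) (show (gens d F).card + 1 ≤ r + 1 by omega)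
      exact (h1.trans_lt h2).trans_le (h3.trans (Nat.le_add_right _ _))

/-- H(k,d,2) ties in the leading coefficient only with the families having a core with |X| = r, G
included, and wins at second order. -/
theorem third_largest_of_eq (hd : 3 ≤ d) (hr : r = d + 1)
    (hN : 240 * r * (r + d) ^ (r + d) ≤ N) (F : Finset (Finset (Fin (N + d)))) :
    IsNthLargest 3 (r + d) d F ↔ IsH (r + d) d 2 F := by
  have hN2 := (large_bounds hd (by omega) hN).2
  have s21 := sizeH_succ_lt hd (by omega) hN
  have s1 : sizeH N r d 2 < sizeH N r d (r + 1) :=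
    (sizeH_two_lt_meetCount hd (by omega) hN).trans_le (by rw [hr]; exact Nat.le_add_right _ _)
  refine isNthLargest_three_iff (P₁ := IsH (r + d) d (r + 1)) (P₂ := IsH (r + d) d (r + 2))
    (fun F hF => hF.spec hd (by omega) (by omega) (by omega))
    (fun F hF => hF.spec hd (by omega) (by omega) (by omega))
    (fun F hF => hF.spec hd (by omega) (by omega) (by omega))
    ⟨_, isH_familyH (by omega) (by omega)⟩ ⟨_, isH_familyH (by omega) (by omega)⟩
    ⟨_, isH_familyH (by omega) (by omega)⟩ s21.ne s1 (s1.trans s21) ?_ F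
  intro F hF
  rcases isH_or_gens_le hF hd (by omega) with h | h | h | ⟨h, hC⟩
  · exact Or.inr (Or.inr (Or.inl h))
  · exact Or.inl h
  · exact Or.inr (Or.inl h)
  refine Or.inr (Or.inr (Or.inr ?_))
  by_cases hg : (gens d F).card ≤ d
  · exact (hF.card_le_gens (by omega) (by omega)).trans_lt
      (general_lt_sizeH_two hd (by omega) hN hg)
  · obtain ⟨D, X, hC, hX⟩ := hC (by omega)
    have e : meetCount N r r = meetCount N r (d + 1) := by rw [← hr]
    rcases hC.isG_or_card_le hF hd (by omega) (by omega) (by omega) with h | h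
    · refine (h.card_le (by omega) (by omega)).trans_lt ?_
      rw [e]
      exact second_order_lt_sizeH_two hd (by omega) hN (by omega) (Or.inl le_rfl)
    · refine h.trans_lt ?_
      rw [e]
      exact second_order_lt_sizeH_two hd (by omega) hN (by omega) (Or.inr le_rfl)

/-- Now d + 1 < r, so H(k,d,2) falls below G. The number s₃ is the size of `familyG` itself, which
is known only through bounds. -/
theorem third_largest_of_lt (hd : 3 ≤ d) (hr : d + 2 ≤ r)
    (hN : 240 * r * (r + d) ^ (r + d) ≤ N) (F : Finset (Finset (Fin (N + d)))) :
    IsNthLargest 3 (r + d) d F ↔ IsG (r + d) d F := by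
  have hN2 := (large_bounds hd (by omega) hN).2
  have s21 := sizeH_succ_lt hd (by omega) hN
  have hG0 : IsG (r + d) d (familyG (N + d) (r + d) d) :=
    isG_familyG (by omega) (by omega) (by omega)
  have s1 : (familyG (N + d) (r + d) d).card < sizeH N r d (r + 1) :=
    (hG0.card_le (by omega) (by omega)).trans_lt
      ((sizeG_lt_meetCount hd (by omega) hN (by omega)).trans_le (Nat.le_add_right _ _))
  have hlow := hG0.le_card (by omega) (by omega)
  have hsmall : ∀ F : Finset (Finset (Fin (N + d))), IsMaxNontrivial (r + d) d F →
      ∀ g < r, F.card ≤ g * N.choose r + (r + d) ^ (d + 1) * (N - 1).choose (r - 1) →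
      F.card < (familyG (N + d) (r + d) d).card := by
    intro F hF g hg hle
    have h2 := general_lt_meetCount hd (by omega) hN (g := g) (by omega)
    have h3 := meetCount_mono (N := N) (r := r) (show g + 1 ≤ r by omega)
    omega
  refine isNthLargest_three_iff (P₁ := IsH (r + d) d (r + 1)) (P₂ := IsH (r + d) d (r + 2))
    (fun F hF => hF.spec hd (by omega) (by omega) (by omega))
    (fun F hF => hF.spec hd (by omega) (by omega) (by omega))
    (fun F hF => ⟨hF.isMaxNontrivial hd (by omega) (by omega),
      ((iso_familyG_iff (by omega) (by omega) (by omega)).2 hF).card_eq⟩)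
    ⟨_, isH_familyH (by omega) (by omega)⟩ ⟨_, isH_familyH (by omega) (by omega)⟩
    ⟨_, hG0⟩ s21.ne s1 (s1.trans s21) ?_ F
  intro F hF
  rcases isH_or_gens_le hF hd (by omega) with h | h | h | ⟨h, hC⟩
  -- H(k,d,2) has at most (d + 1) · C(N, r) members, so it obeys the bound for d + 1 < r generators.
  · refine Or.inr (Or.inr (Or.inr (hsmall F hF (d + 1) (by omega) ?_)))
    rw [(h.spec hd (by omega) (by omega) (by omega)).2, sizeH_two (by omega)]
    have h1 : (N - 1).choose r ≤ N.choose r := Nat.choose_le_choose r (by omega)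
    have h2 := Nat.mul_le_mul_left d h1
    rw [add_mul, one_mul]
    omega
  · exact Or.inl h
  · exact Or.inr (Or.inl h)
  by_cases hg : (gens d F).card < r
  · exact Or.inr (Or.inr (Or.inr
      (hsmall F hF _ hg (hF.card_le_gens (by omega) (by omega)))))
  · obtain ⟨D, X, hC, hX⟩ := hC (by omega)
    rcases hC.isG_or_card_le hF hd (by omega) (by omega) (by omega) with h | h
    · exact Or.inr (Or.inr (Or.inl h))
    · have := lt_sizeG hd (by omega) hN (by omega)
      exact Or.inr (Or.inr (Or.inr (by omega)))

end

end DWise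

theorem mainTheorem4 (k d n : ℕ) (hd : 4 ≤ d + 1) (hk : d + 1 < k) (hn : DWise.n₁ k d < n)
    (F : Finset (Finset (Fin n))) :
    (k ≤ 2 * d →
      (DWise.IsNthLargest 3 k d F ↔ DWise.Iso F (DWise.familyH n k d (k - d + 1)))) ∧
    (k = 2 * d + 1 →
      (DWise.IsNthLargest 3 k d F ↔ DWise.Iso F (DWise.familyH n (2 * d + 1) d 2))) ∧
    (2 * d + 1 < k →
      (DWise.IsNthLargest 3 k d F ↔ DWise.Iso F (DWise.familyG n k d))) := by
  -- Writing k = r + d and n = N + d removes the truncated subtractions.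
  obtain ⟨r, rfl⟩ : ∃ r, k = r + d := ⟨k - d, by omega⟩
  obtain ⟨N, rfl⟩ : ∃ N, n = N + d := ⟨n - d, by rw [DWise.n₁] at hn; omega⟩
  have hN := DWise.le_of_threshold_lt (by omega) (by omega) hn
  have hN2 := (DWise.large_bounds (by omega) (by omega) hN).2
  refine ⟨fun h => ?_, fun h => ?_, fun h => ?_⟩
  · rw [Nat.add_sub_cancel, DWise.iso_familyH_iff (by omega) (by omega)]
    exact DWise.third_largest_of_le (by omega) (by omega) hN (by omega) F
  · rw [← h, DWise.iso_familyH_iff (by omega) (by omega)]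
    exact DWise.third_largest_of_eq (by omega) (by omega) hN F
  · rw [DWise.iso_familyG_iff (by omega) (by omega) (by omega)]
    exact DWise.third_largest_of_lt (by omega) (by omega) hN F
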